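/- **Conventions.** All Hilbert spaces are finite-dimensional; $\mathbb 1_X$ is the identity, $|X|$ the dimension, and $\pi_X=|X|^{-1}\mathbb 1_X$ the maximally mixed state of $X$. For a state $\rho$ with nonzero eigenvalues $\lambda_k$ (with multiplicity) and real $\alpha\ge 0$, the Rényi entropy is $S_\alpha(\rho)=\frac{1}{1-\alpha}\log_2\sum_k\lambda_k^\alpha$ for $\alpha\neq1$ (so $S_0(\rho)=\log_2\operatorname{rank}\rho$) and $S_1(\rho)=-\sum_k\lambda_k\log_2\lambda_k$. **Delocalized catalysis.** Let $\sigma_{B_0B_1}$ be a bipartite state. Unitaries $U_0$ on $A_0\otimes B_0$ and $U_1$ on $A_1\otimes B_1$ are *compatible* with $\sigma$ if $$\operatorname{Tr}_{A_0A_1}\big[(U_0\otimes U_1)(\rho_{A_0A_1}\otimes\sigma_{B_0B_1})(U_0\otimes U_1)^\dagger\big]=\sigma_{B_0B_1}\quad\text{for every state }\rho_{A_0A_1}.$$ Then put $\mathcal N(\rho)=\operatorname{Tr}_{B_0B_1}\big[(U_0\otimes U_1)(\rho\otimes\sigma)(U_0\otimes U_1)^\dagger\big]$. The Rényi entropy of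 order $\alpha$ extracted from $\sigma$ with initial state $\rho$ is $S_\alpha(\mathcal N(\rho))-S_\alpha(\rho)$. **Essential decomposition.** Let $\rho_{AB}$ be a state. An orthogonal decomposition $A=\bigoplus_iA_i$ into nonzero subspaces with projectors $\Pi_i$, each index being labelled type I or type II, is an *essential decomposition* of $A$ for $\rho_{AB}$ if 1. $[\Pi_i\otimes\mathbb 1_B,\rho_{AB}]=0$ for every $i$; 2. for $i$ of type I, no projective measurement on $A_i$ with at least two (nonzero) outcome projectors $Q_k$ leaves $X_i=(\Pi_i\otimes\mathbb 1_B)\rho_{AB}(\Pi_i\otimes\mathbb 1_B)$ unperturbed, i.e. satisfies $X_i=\sum_k(Q_k\otimes\mathbb 1_B)X_i(Q_k\otimes\mathbb 1_B)$; for $i$ of type II, $X_i=p_i\,\pi_{A_i}\otimes\omega_B$ for some state $\omega_B$, where $p_i=\operatorname{Tr}X_i\ge0$; 3. every projector $P$ on $A$ that fails to commute with some $\Pi_i$ satisfies $[P\otimes\mathbb 1_B,\rho_{AB}]\ne0$. Essential decompositions of $B$ are defined in the same way with the roles of $A$ and $B$ exchanged. **Theorem.** Let $\sigma_{B_0B_1}$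 be a state with essential decompositions $B_0=\bigoplus_iB_{0i}$ and $B_1=\bigoplus_jB_{1j}$, with projectors $\Pi_i^{0}$ and $\Pi_j^{1}$. Let $p_{ij}=\operatorname{Tr}[(\Pi^0_i\otimes\Pi^1_j)\sigma]$. Let $\tau_i$ be a pure state if $i$ is of type I and the maximally mixed state of dimension $|B_{0i}|^2$ if $i$ is of type II, and let $\kappa_j$ be a pure state if $j$ is of type I and the maximally mixed state of dimension $|B_{1j}|^2$ if $j$ is of type II. Let $$\mathfrak d(\sigma)=\bigoplus_{i,j}p_{ij}\,\tau_i\otimes\kappa_j$$ be the delocalized randomness-exhausting output (DREO), the direct sum being over mutually orthogonal copies. Then for every real $\alpha\ge0$ the maximum of the extracted entropy $S_\alpha(\mathcal N(\rho))-S_\alpha(\rho)$, over all finite-dimensional systems $A_0,A_1$, all compatible pairs $(U_0,U_1)$ and all initial states $\rho$ of $A_0A_1$, exists and equals the delocalized catalytic Rényi entropy $S_\alpha(\mathfrak d(\sigma))$. Likewise the maximum of $S_\alpha(\mathcal N(\rho))$ over the pure initial states $\rho$ exists and equals $S_\alpha(\mathfrak d(\sigma))$. -/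

import Mathlib

open Matrix
open scoped Kronecker ComplexOrder

noncomputable section

namespace DelocalizedCatalysis

/-! ### States, partial traces, Rényi entropies -/

/-- A quantum state (density matrix). -/
def IsState {n : Type*} [Fintype n] (ρ : Matrix n n ℂ) : Prop :=
  ρ.PosSemidef ∧ ρ.trace = 1

/-- A pure state `|v⟩⟨v|`. -/
def IsPureState {n : Type*} [Fintype n] (ρ : Matrix n n ℂ) : Prop :=
  IsState ρ ∧ ∃ v : n → ℂ, ρ = vecMulVec v (star v)

/-- `Tr_Y` on the system `X ⊗ Y`. -/
def traceRight {x y : Type*} [Fintype y] (M : Matrix (x × y) (x × y) ℂ) : Matrix x x ℂ :=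
  fun i j => ∑ k, M (i, k) (j, k)

/-- `Tr_X` on the system `X ⊗ Y`. -/
def traceLeft {x y : Type*} [Fintype x] (M : Matrix (x × y) (x × y) ℂ) : Matrix y y ℂ :=
  fun i j => ∑ k, M (k, i) (k, j)

/-- The nonzero eigenvalues, with multiplicity, of a matrix with real spectrum. -/
def nonzeroSpectrum {n : Type*} [Fintype n] [DecidableEq n] (ρ : Matrix n n ℂ) : Multiset ℝ :=
  (ρ.charpoly.roots.map Complex.re).filter (fun x => x ≠ 0)

/-- The Rényi entropy (in bits) of order `α` of a state: the von Neumann entropy for `α = 1`, and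
`(1 - α)⁻¹ log₂ ∑ λ ^ α`, over the nonzero eigenvalues `λ`, for `α ≠ 1`
(in particular `log₂ (rank ρ)` for `α = 0`). -/
def renyiEntropy {n : Type*} [Fintype n] [DecidableEq n] (α : ℝ) (ρ : Matrix n n ℂ) : ℝ :=
  if α = 1 then ((nonzeroSpectrum ρ).map (fun x => -(x * Real.logb 2 x))).sum
  else (1 - α)⁻¹ * Real.logb 2 ((nonzeroSpectrum ρ).map (fun x => x ^ α)).sum

/-! ### Delocalized catalysis -/

/-- `U₀ ⊗ U₁`, with `U₀` acting on `A₀B₀` and `U₁` on `A₁B₁`, as an operator on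
`(A₀A₁) ⊗ (B₀B₁)`. -/
def pairUnitary {a₀ a₁ b₀ b₁ : Type*} (U₀ : Matrix (a₀ × b₀) (a₀ × b₀) ℂ)
    (U₁ : Matrix (a₁ × b₁) (a₁ × b₁) ℂ) :
    Matrix ((a₀ × a₁) × (b₀ × b₁)) ((a₀ × a₁) × (b₀ × b₁)) ℂ :=
  (U₀ ⊗ₖ U₁).submatrix (Equiv.prodProdProdComm a₀ a₁ b₀ b₁) (Equiv.prodProdProdComm a₀ a₁ b₀ b₁)

section
variable {a₀ a₁ b₀ b₁ : Type*} [Fintype a₀] [Fintype a₁] [Fintype b₀] [Fintype b₁]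

/-- The joint state `(U₀ ⊗ U₁) (ρ ⊗ σ) (U₀ ⊗ U₁)†` after the interaction. -/
def jointOutput (U₀ : Matrix (a₀ × b₀) (a₀ × b₀) ℂ) (U₁ : Matrix (a₁ × b₁) (a₁ × b₁) ℂ)
    (σ : Matrix (b₀ × b₁) (b₀ × b₁) ℂ) (ρ : Matrix (a₀ × a₁) (a₀ × a₁) ℂ) :
    Matrix ((a₀ × a₁) × (b₀ × b₁)) ((a₀ × a₁) × (b₀ × b₁)) ℂ :=
  pairUnitary U₀ U₁ * (ρ ⊗ₖ σ) * (pairUnitary U₀ U₁)ᴴ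

/-- The state of `A₀A₁` after the interaction. -/
def catalyticMap (U₀ : Matrix (a₀ × b₀) (a₀ × b₀) ℂ) (U₁ : Matrix (a₁ × b₁) (a₁ × b₁) ℂ)
    (σ : Matrix (b₀ × b₁) (b₀ × b₁) ℂ) (ρ : Matrix (a₀ × a₁) (a₀ × a₁) ℂ) :
    Matrix (a₀ × a₁) (a₀ × a₁) ℂ :=
  traceRight (jointOutput U₀ U₁ σ ρ)

/-- The source `σ` is returned unchanged, whatever the initial state of `A₀A₁`. -/
def IsCompatible (U₀ : Matrix (a₀ × b₀) (a₀ × b₀) ℂ) (U₁ : Matrix (a₁ × b₁) (a₁ × b₁) ℂ)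
    (σ : Matrix (b₀ × b₁) (b₀ × b₁) ℂ) : Prop :=
  ∀ ρ : Matrix (a₀ × a₁) (a₀ × a₁) ℂ, IsState ρ → traceLeft (jointOutput U₀ U₁ σ ρ) = σ

end

section
variable {b₀ b₁ : Type*} [Fintype b₀] [Fintype b₁] [DecidableEq b₀] [DecidableEq b₁]

/-- The amounts of Rényi entropy that can be catalytically extracted from `σ`: the entropy
increases `S_α(𝒩(ρ)) - S_α(ρ)` over all finite-dimensional systems `A₀`, `A₁`, all initial states
`ρ` of `A₀A₁` and all compatible pairs of local unitaries. Local reference systems that do not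
interact with the source can be taken as parts of `A₀` and `A₁`. -/
def extractable (α : ℝ) (σ : Matrix (b₀ × b₁) (b₀ × b₁) ℂ) : Set ℝ :=
  {s | ∃ (n₀ n₁ : ℕ) (U₀ : Matrix (Fin n₀ × b₀) (Fin n₀ × b₀) ℂ)
      (U₁ : Matrix (Fin n₁ × b₁) (Fin n₁ × b₁) ℂ) (ρ : Matrix (Fin n₀ × Fin n₁) _ ℂ),
    U₀ ∈ unitaryGroup (Fin n₀ × b₀) ℂ ∧ U₁ ∈ unitaryGroup (Fin n₁ × b₁) ℂ ∧
    IsCompatible U₀ U₁ σ ∧ IsState ρ ∧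
    s = renyiEntropy α (catalyticMap U₀ U₁ σ ρ) - renyiEntropy α ρ}

/-- The Rényi entropies of the states that can be catalytically created with `σ` from pure initial
states. -/
def extractableFromPure (α : ℝ) (σ : Matrix (b₀ × b₁) (b₀ × b₁) ℂ) : Set ℝ :=
  {s | ∃ (n₀ n₁ : ℕ) (U₀ : Matrix (Fin n₀ × b₀) (Fin n₀ × b₀) ℂ)
      (U₁ : Matrix (Fin n₁ × b₁) (Fin n₁ × b₁) ℂ) (ρ : Matrix (Fin n₀ × Fin n₁) _ ℂ),
    U₀ ∈ unitaryGroup (Fin n₀ × b₀) ℂ ∧ U₁ ∈ unitaryGroup (Fin n₁ × b₁) ℂ ∧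
    IsCompatible U₀ U₁ σ ∧ IsPureState ρ ∧
    s = renyiEntropy α (catalyticMap U₀ U₁ σ ρ)}

end

/-! ### Essential decompositions -/

section
variable {a b ι κ : Type*} [Fintype a] [Fintype b] [Fintype ι] [Fintype κ]
  [DecidableEq a] [DecidableEq b] [DecidableEq ι] [DecidableEq κ]

/-- `(P ⊗ 1) ρ (P ⊗ 1)`. -/
def compress (P : Matrix a a ℂ) (ρ : Matrix (a × b) (a × b) ℂ) : Matrix (a × b) (a × b) ℂ :=
  (P ⊗ₖ (1 : Matrix b b ℂ)) * ρ * (P ⊗ₖ (1 : Matrix b b ℂ))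

/-- For an operator `X` supported on `supp P ⊗ B`: `X` is partially classical-quantum as an
operator on `supp P ⊗ B`, that is, some projective measurement on `supp P` with more than one
outcome leaves `X` unperturbed. -/
def IsPartiallyClassicalOn (P : Matrix a a ℂ) (X : Matrix (a × b) (a × b) ℂ) : Prop :=
  ∃ (n : ℕ) (Q : Fin n → Matrix a a ℂ), 1 < n ∧
    (∀ k, IsStarProjection (Q k) ∧ Q k ≠ 0) ∧ (∀ k l, k ≠ l → Q k * Q l = 0) ∧
    ∑ k, Q k = P ∧ X = ∑ k, compress (Q k) X

inductive SectorType where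
  | I
  | II

/-- `A = ⨁ᵢ supp (P i)`, with sector types `t`, is the essential decomposition of the first system
`A` for the state `ρ` of `AB`. In a type II sector `(P i ⊗ 1) ρ (P i ⊗ 1)` is the maximally mixed
state of the sector tensored with a state of `B`, up to normalization; the weight may be zero. -/
structure IsEssentialDecomposition (ρ : Matrix (a × b) (a × b) ℂ) (P : ι → Matrix a a ℂ)
    (t : ι → SectorType) : Prop where
  isStarProjection : ∀ i, IsStarProjection (P i)
  ne_zero : ∀ i, P i ≠ 0
  orthogonal : ∀ i j, i ≠ j → P i * P j = 0
  sum_eq_one : ∑ i, P i = 1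
  commute : ∀ i, Commute (P i ⊗ₖ (1 : Matrix b b ℂ)) ρ
  typeI : ∀ i, t i = SectorType.I → ¬ IsPartiallyClassicalOn (P i) (compress (P i) ρ)
  typeII : ∀ i, t i = SectorType.II → ∃ ω : Matrix b b ℂ, IsState ω ∧
    compress (P i) ρ =
      (compress (P i) ρ).trace • ((((P i).rank : ℂ)⁻¹ • P i) ⊗ₖ ω)
  maximal : ∀ Q : Matrix a a ℂ, IsStarProjection Q → (∃ i, ¬ Commute Q (P i)) →
    ¬ Commute (Q ⊗ₖ (1 : Matrix b b ℂ)) ρ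

/-- The same state with the two systems exchanged. -/
def swapState (ρ : Matrix (a × b) (a × b) ℂ) : Matrix (b × a) (b × a) ℂ :=
  ρ.submatrix Prod.swap Prod.swap

/-! ### The delocalized randomness-exhausting output -/

/-- The dimension contributed by a sector of dimension `d`: `1` for type I, `d²` for type II. -/
def outputDim : SectorType → ℕ → ℕ
  | SectorType.I, _ => 1
  | SectorType.II, d => d ^ 2

/-- The maximally mixed state of dimension `m`; for `m = 1` this is the pure state `|0⟩⟨0|`. -/
def maximallyMixed (m : ℕ) : Matrix (Fin m) (Fin m) ℂ :=
  (m : ℂ)⁻¹ • 1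

/-- The delocalized randomness-exhausting output `⨁ᵢⱼ pᵢⱼ τᵢ ⊗ κⱼ`, with
`pᵢⱼ = Tr[(Pᵢ ⊗ Qⱼ) ρ]`; `P`, `t` and `Q`, `u` are the decompositions of `A` and `B`. -/
def dreo (ρ : Matrix (a × b) (a × b) ℂ) (P : ι → Matrix a a ℂ) (t : ι → SectorType)
    (Q : κ → Matrix b b ℂ) (u : κ → SectorType) :
    Matrix (Σ ij : ι × κ, Fin (outputDim (t ij.1) (P ij.1).rank) ×
        Fin (outputDim (u ij.2) (Q ij.2).rank))
      (Σ ij : ι × κ, Fin (outputDim (t ij.1) (P ij.1).rank) ×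
        Fin (outputDim (u ij.2) (Q ij.2).rank)) ℂ :=
  blockDiagonal' fun ij =>
    ((P ij.1 ⊗ₖ Q ij.2) * ρ).trace •
      (maximallyMixed (outputDim (t ij.1) (P ij.1).rank) ⊗ₖ
        maximallyMixed (outputDim (u ij.2) (Q ij.2).rank))

/-- The delocalized catalytic Rényi entropy. -/
def delocalizedCatalyticEntropy (α : ℝ) (ρ : Matrix (a × b) (a × b) ℂ) (P : ι → Matrix a a ℂ)
    (t : ι → SectorType) (Q : κ → Matrix b b ℂ) (u : κ → SectorType) : ℝ :=
  renyiEntropy α (dreo ρ P t Q u)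

end

end DelocalizedCatalysis

end

open DelocalizedCatalysis

namespace DelocalizedCatalysis

/-! ### Spectral sums -/

section SpectralSums

variable {n m ι : Type*} [Fintype n] [Fintype m] [Fintype ι] [DecidableEq n] [DecidableEq m]

/-! The proof rests on the local commutant of `σ`: the operators on one half of the source that
commute with `σ` when tensored with the identity. Conditions 1–3 of an essential decomposition
describe it. Its elements commute with every sector projector (`commute_of_mem`), are scalar on type
I sectors (`exists_mul_eq_smul_of_typeI`), and include every operator supported in a type II sector
(`mem_localCommutant_of_typeII`). Hence on products of elements of the two commutants, `σ` acts as a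
classical mixture, with weights `p_ij`, of products of normalized sector traces
(`trace_kronecker_mul_eq_sum`).

Upper bound. Testing compatibility on the maximally mixed input forces the pair of unitaries to
commute with `1 ⊗ σ`, by an equality case in Hilbert–Schmidt norm (`block_commute_of_traceLeft`).
With unitarity on the other side, the products `Uᴴ_{χ'φ'} U_{χφ}` of blocks of each local unitary
lie in its local commutant, and the output depends on these products alone. In a type I sector the
unitary then acts as a unitary of the system (`exists_unitary_of_scalar`). In a type II sector of
dimension `d` it acts as a `d × d` array of Kraus operators, isometric in one index, averaged
uniformly over the other (`exists_kraus_of_commute`). An output of this form is `T Tᴴ`, and `Tᴴ T`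
has the same nonzero spectrum. Schur's diagonal inequality and Jensen's inequality show that the
output majorizes `𝔡(σ) ⊗ ρ` (`sum_map_nonzeroSpectrum_kraus_le`). Schur concavity and additivity of
Rényi entropies then bound the gain for all `α ≥ 0` (`familyEntropy_le_add`).

Attainability. A register labelled by the eigenvectors of the local factor of the DREO controls
which of `d²` orthogonal unitaries is applied in each type II sector, and it also records the
sector. Its coherences are killed by orthogonality, so a pure input yields exactly the spectrum of
`𝔡(σ)` (`exists_protocol`, `exists_optimal_protocol`). -/

theorem sum_map_nonzeroSpectrum_of_charpoly {M : Matrix n n ℂ} {v : ι → ℝ}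
    (h : M.charpoly = ∏ x, (Polynomial.X - Polynomial.C (v x : ℂ))) {f : ℝ → ℝ} (hf : f 0 = 0) :
    ((nonzeroSpectrum M).map f).sum = ∑ x, f (v x) := by
  have hroots : M.charpoly.roots = Finset.univ.val.map (fun x => (v x : ℂ)) := by
    rw [h, Finset.prod_eq_multiset_prod,
      ← Polynomial.roots_multiset_prod_X_sub_C (Finset.univ.val.map fun x => (v x : ℂ)),
      Multiset.map_map]
    rfl
  have hfilter : ∀ s : Multiset ℝ, ((s.filter (fun x => x ≠ 0)).map f).sum = (s.map f).sum := by
    intro s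
    induction s using Multiset.induction_on with
    | empty => simp
    | cons a s ih =>
      by_cases ha : a = 0
      · rw [Multiset.filter_cons_of_neg _ (by simpa using ha), ih]
        simp [ha, hf]
      · rw [Multiset.filter_cons_of_pos (p := fun x : ℝ => x ≠ 0) s ha]
        simp only [Multiset.map_cons, Multiset.sum_cons, ih]
  rw [nonzeroSpectrum, hfilter, hroots, Multiset.map_map, Multiset.map_map,
    Finset.sum_eq_multiset_sum]
  simp [Function.comp_def]

theorem sum_map_nonzeroSpectrum {M : Matrix n n ℂ} (hM : M.IsHermitian) {f : ℝ → ℝ}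
    (hf : f 0 = 0) : ((nonzeroSpectrum M).map f).sum = ∑ x, f (hM.eigenvalues x) :=
  sum_map_nonzeroSpectrum_of_charpoly (by simpa using hM.charpoly_eq) hf

/-- The two characteristic polynomials agree up to powers of `X`, which contribute only zero roots.
-/
theorem nonzeroSpectrum_mul_comm (A : Matrix n m ℂ) (B : Matrix m n ℂ) :
    nonzeroSpectrum (A * B) = nonzeroSpectrum (B * A) := by
  have key : ∀ (k : ℕ) (p : Polynomial ℂ), p ≠ 0 →
      (((Polynomial.X ^ k * p).roots.map Complex.re).filter (fun x => x ≠ 0)) =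
        ((p.roots.map Complex.re).filter (fun x => x ≠ 0)) := by
    intro k p hp
    rw [Polynomial.roots_mul (mul_ne_zero (pow_ne_zero _ Polynomial.X_ne_zero) hp),
      Polynomial.roots_X_pow, Multiset.map_add, Multiset.filter_add]
    simp [Multiset.filter_eq_nil, Multiset.map_nsmul, Multiset.mem_nsmul]
  have h := Matrix.charpoly_mul_comm' A B
  have h1 := key (Fintype.card m) _ (A * B).charpoly_monic.ne_zero
  have h2 := key (Fintype.card n) _ (B * A).charpoly_monic.ne_zero
  rw [nonzeroSpectrum, nonzeroSpectrum, ← h1, ← h2, h]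

theorem _root_.Matrix.IsHermitian.apply_eq_sum {M : Matrix n n ℂ} (hM : M.IsHermitian) (x x' : n) :
    M x x' = ∑ y, (hM.eigenvectorUnitary : Matrix n n ℂ) x y * hM.eigenvalues y *
      star ((hM.eigenvectorUnitary : Matrix n n ℂ) x' y) := by
  conv_lhs => rw [hM.spectral_theorem]
  simp [Unitary.conjStarAlgAut_apply, Matrix.mul_apply, Matrix.diagonal_apply,
    Matrix.star_eq_conjTranspose]

theorem sum_normSq_row_eq_one {U : Matrix n n ℂ} (hU : U ∈ unitaryGroup n ℂ) (x : n) :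
    ∑ y, Complex.normSq (U x y) = 1 := by
  have h := congrFun (congrFun (mem_unitaryGroup_iff.mp hU) x) x
  rw [Matrix.mul_apply] at h
  apply_fun Complex.re at h
  simpa [Matrix.star_apply, Complex.normSq_apply] using h

theorem sum_normSq_col_eq_one {U : Matrix n n ℂ} (hU : U ∈ unitaryGroup n ℂ) (y : n) :
    ∑ x, Complex.normSq (U x y) = 1 := by
  have h := congrFun (congrFun (mem_unitaryGroup_iff'.mp hU) y) y
  rw [Matrix.mul_apply] at h
  apply_fun Complex.re at h
  simpa [Matrix.star_apply, Complex.normSq_apply] using h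

/-- Schur's theorem: the diagonal is majorized by the spectrum. -/
theorem sum_eigenvalues_le_sum_diag {G : Matrix n n ℂ} (hG : G.PosSemidef) {f : ℝ → ℝ}
    (hf : ConcaveOn ℝ (Set.Ici 0) f) :
    ∑ y, f (hG.isHermitian.eigenvalues y) ≤ ∑ x, f (G x x).re := by
  set U : Matrix n n ℂ := hG.isHermitian.eigenvectorUnitary.1 with hUdef
  have hU : U ∈ unitaryGroup n ℂ := (hG.isHermitian.eigenvectorUnitary).2
  -- Each diagonal entry is an average of eigenvalues with weights `|U x y|²`. This weight matrix is
  -- doubly stochastic: its rows permit Jensen, its columns collapse the sum.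
  have hdiag : ∀ x, (G x x).re = ∑ y, Complex.normSq (U x y) • hG.isHermitian.eigenvalues y := by
    intro x
    rw [hG.isHermitian.apply_eq_sum, Complex.re_sum]
    refine Finset.sum_congr rfl fun y _ => ?_
    simp [hUdef, Complex.normSq_apply]
    ring
  calc ∑ y, f (hG.isHermitian.eigenvalues y)
      = ∑ y, (∑ x, Complex.normSq (U x y)) * f (hG.isHermitian.eigenvalues y) := by
        simp [sum_normSq_col_eq_one hU]
    _ = ∑ x, ∑ y, Complex.normSq (U x y) • f (hG.isHermitian.eigenvalues y) := by
        rw [Finset.sum_comm]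
        simp [Finset.sum_mul]
    _ ≤ ∑ x, f (G x x).re := by
        refine Finset.sum_le_sum fun x _ => ?_
        rw [hdiag]
        exact hf.le_map_sum (fun y _ => Complex.normSq_nonneg _) (sum_normSq_row_eq_one hU x)
          (fun y _ => hG.eigenvalues_nonneg y)

end SpectralSums

/-! ### Rényi entropies of finite families -/

section Entropy

/-- `x ↦ x ^ α` on the positive reals, extended by `0` at `0`. -/
noncomputable def powOrZero (α x : ℝ) : ℝ := if x = 0 then 0 else x ^ α

/-- The Rényi entropy of a finite family of nonnegative weights. -/
noncomputable def familyEntropy {ι : Type*} [Fintype ι] (α : ℝ) (v : ι → ℝ) : ℝ :=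
  if α = 1 then ∑ x, -(v x * Real.logb 2 (v x))
  else (1 - α)⁻¹ * Real.logb 2 (∑ x, powOrZero α (v x))

variable {n ι κ : Type*} [Fintype n] [DecidableEq n] [Fintype ι] [Fintype κ]

/-- Using `powOrZero` instead of `x ^ α` makes the summand vanish at `0` even for `α = 0`, where `0
^ 0 = 1` would count zero eigenvalues. Sums may then run over the full spectrum. -/
theorem renyiEntropy_eq_spectral (α : ℝ) (M : Matrix n n ℂ) :
    renyiEntropy α M =
      if α = 1 then ((nonzeroSpectrum M).map (fun x => -(x * Real.logb 2 x))).sum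
      else (1 - α)⁻¹ * Real.logb 2 ((nonzeroSpectrum M).map (powOrZero α)).sum := by
  have : (nonzeroSpectrum M).map (powOrZero α) = (nonzeroSpectrum M).map (fun x => x ^ α) := by
    refine Multiset.map_congr rfl fun x hx => ?_
    rw [powOrZero, if_neg (Multiset.mem_filter.mp hx).2]
  rw [renyiEntropy, this]

theorem renyiEntropy_of_charpoly {M : Matrix n n ℂ} {v : ι → ℝ}
    (h : M.charpoly = ∏ x, (Polynomial.X - Polynomial.C (v x : ℂ))) (α : ℝ) :
    renyiEntropy α M = familyEntropy α v := by
  rw [renyiEntropy_eq_spectral, familyEntropy,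
    sum_map_nonzeroSpectrum_of_charpoly h (f := fun x => -(x * Real.logb 2 x)) (by simp),
    sum_map_nonzeroSpectrum_of_charpoly h (f := powOrZero α) (by simp [powOrZero])]

theorem renyiEntropy_diagonal (v : n → ℝ) (α : ℝ) :
    renyiEntropy α (diagonal fun x => (v x : ℂ)) = familyEntropy α v :=
  renyiEntropy_of_charpoly (charpoly_diagonal _) α

theorem renyiEntropy_eq_familyEntropy {M : Matrix n n ℂ} (hM : M.IsHermitian) (α : ℝ) :
    renyiEntropy α M = familyEntropy α hM.eigenvalues :=
  renyiEntropy_of_charpoly (by simpa using hM.charpoly_eq) α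

theorem familyEntropy_congr {v : ι → ℝ} {w : κ → ℝ}
    (h : ∀ f : ℝ → ℝ, ∑ x, f (v x) = ∑ y, f (w y)) (α : ℝ) :
    familyEntropy α v = familyEntropy α w := by
  rw [familyEntropy, familyEntropy, h fun x => -(x * Real.logb 2 x), h (powOrZero α)]

theorem powOrZero_nonneg {α x : ℝ} (hx : 0 ≤ x) : 0 ≤ powOrZero α x := by
  unfold powOrZero
  split_ifs
  · rfl
  · exact Real.rpow_nonneg hx _

theorem powOrZero_mul {α x y : ℝ} (hx : 0 ≤ x) (hy : 0 ≤ y) :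
    powOrZero α (x * y) = powOrZero α x * powOrZero α y := by
  by_cases h1 : x = 0
  · simp [powOrZero, h1]
  by_cases h2 : y = 0
  · simp [powOrZero, h2]
  simp [powOrZero, h1, h2, Real.mul_rpow hx hy]

theorem powOrZero_of_pos {α : ℝ} (hα : 0 < α) : powOrZero α = fun x => x ^ α := by
  funext x
  unfold powOrZero
  split_ifs with h
  · rw [h, Real.zero_rpow hα.ne']
  · rfl

/-- Only `α = 0` differs from the usual power function. There the function is the indicator of the
positive reals, and a convex combination of nonnegative numbers vanishes only if every term of it
does. -/
theorem concaveOn_powOrZero {α : ℝ} (h0 : 0 ≤ α) (h1 : α ≤ 1) :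
    ConcaveOn ℝ (Set.Ici 0) (powOrZero α) := by
  rcases h0.eq_or_lt with rfl | hpos
  · refine ⟨convex_Ici 0, fun x hx y hy a b ha hb hab => ?_⟩
    simp only [Set.mem_Ici] at hx hy
    have hle : ∀ z : ℝ, powOrZero 0 z ≤ 1 := fun z => by
      unfold powOrZero
      split_ifs <;> simp
    by_cases hz : a • x + b • y = 0
    · have hax : a * x = 0 := by
        have := mul_nonneg ha hx
        have := mul_nonneg hb hy
        simp only [smul_eq_mul] at hz
        linarith
      have hby : b * y = 0 := by
        simp only [smul_eq_mul] at hz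
        linarith
      have e1 : a * powOrZero 0 x = 0 := by
        rcases mul_eq_zero.mp hax with h | h <;> simp [h, powOrZero]
      have e2 : b * powOrZero 0 y = 0 := by
        rcases mul_eq_zero.mp hby with h | h <;> simp [h, powOrZero]
      rw [smul_eq_mul, smul_eq_mul, e1, e2, hz]
      simp [powOrZero]
    · have : powOrZero 0 (a • x + b • y) = 1 := by
        rw [powOrZero, if_neg hz, Real.rpow_zero]
      rw [this, smul_eq_mul, smul_eq_mul]
      nlinarith [hle x, hle y]
  · rw [powOrZero_of_pos hpos]
    exact Real.concaveOn_rpow h0 h1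

theorem sum_powOrZero_pos {v : ι → ℝ} (hv : ∀ x, 0 ≤ v x) (hs : ∑ x, v x = 1) (α : ℝ) :
    0 < ∑ x, powOrZero α (v x) := by
  obtain ⟨x, hx⟩ : ∃ x, v x ≠ 0 := by
    by_contra! h
    simp [h] at hs
  refine Finset.sum_pos' (fun y _ => powOrZero_nonneg (hv y)) ⟨x, Finset.mem_univ _, ?_⟩
  rw [powOrZero, if_neg hx]
  exact Real.rpow_pos_of_pos ((hv x).lt_of_ne' hx) _

/-- If `v` majorizes the product of the distributions `q` and `r`, its Rényi entropy is at most the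
sum of those of `q` and `r`. -/
theorem familyEntropy_le_add {τ : Type*} [Fintype τ] {v : τ → ℝ} {q : ι → ℝ} {r : κ → ℝ}
    (hv : ∀ x, 0 ≤ v x) (hv1 : ∑ x, v x = 1) (hq : ∀ x, 0 ≤ q x) (hq1 : ∑ x, q x = 1)
    (hr : ∀ x, 0 ≤ r x) (hr1 : ∑ x, r x = 1)
    (h : ∀ f : ℝ → ℝ, ConcaveOn ℝ (Set.Ici 0) f → f 0 = 0 →
      ∑ x, f (v x) ≤ ∑ x, ∑ y, f (q x * r y)) {α : ℝ} (hα : 0 ≤ α) :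
    familyEntropy α v ≤ familyEntropy α q + familyEntropy α r := by
  have hprod : ∑ x, ∑ y, powOrZero α (q x * r y) =
      (∑ x, powOrZero α (q x)) * ∑ y, powOrZero α (r y) := by
    rw [Finset.sum_mul_sum]
    exact Finset.sum_congr rfl fun x _ => Finset.sum_congr rfl fun y _ =>
      powOrZero_mul (hq x) (hr y)
  have pv := sum_powOrZero_pos hv hv1 α
  have pq := sum_powOrZero_pos hq hq1 α
  have pr := sum_powOrZero_pos hr hr1 α
  unfold familyEntropy
  -- The prefactor `(1 - α)⁻¹` changes sign at `1`, exactly where the power function turns from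
  -- concave to convex. The test functions are `x ^ α`, `-x log x` and `-x ^ α` respectively.
  rcases lt_trichotomy α 1 with hlt | rfl | hgt
  · rw [if_neg hlt.ne, if_neg hlt.ne, if_neg hlt.ne, ← mul_add, ← Real.logb_mul pq.ne' pr.ne',
      ← hprod]
    refine mul_le_mul_of_nonneg_left ?_ (inv_nonneg.mpr (by linarith))
    exact Real.logb_le_logb_of_le one_lt_two pv
      (h _ (concaveOn_powOrZero hα hlt.le) (by simp [powOrZero]))
  · simp only [if_true]
    have hneg : ∀ x : ℝ, -(x * Real.logb 2 x) = Real.negMulLog x / Real.log 2 := fun x => by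
      rw [Real.negMulLog, Real.logb]
      ring
    simp only [hneg, ← Finset.sum_div, ← add_div]
    refine div_le_div_of_nonneg_right ?_ (Real.log_nonneg one_le_two)
    refine (h _ Real.concaveOn_negMulLog Real.negMulLog_zero).trans_eq ?_
    simp only [Real.negMulLog_mul, Finset.sum_add_distrib, ← Finset.mul_sum, ← Finset.sum_mul,
      hq1, hr1, one_mul]
  · rw [if_neg hgt.ne', if_neg hgt.ne', if_neg hgt.ne', ← mul_add, ← Real.logb_mul pq.ne' pr.ne',
      ← hprod]
    refine mul_le_mul_of_nonpos_left ?_ (inv_nonpos.mpr (by linarith))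
    refine Real.logb_le_logb_of_le one_lt_two (hprod ▸ mul_pos pq pr) ?_
    have hc : ConcaveOn ℝ (Set.Ici 0) (fun x => -powOrZero α x) := by
      rw [powOrZero_of_pos (by linarith)]
      exact (convexOn_rpow hgt.le).neg
    have := h _ hc (by simp [powOrZero])
    simp only [Finset.sum_neg_distrib] at this
    linarith

/-- The products `v v*` and `v* v` have the same nonzero spectrum, and the latter is the `1 × 1`
matrix with entry `1`. -/
theorem renyiEntropy_of_isPureState {ρ : Matrix n n ℂ} (h : IsPureState ρ) (α : ℝ) :
    renyiEntropy α ρ = 0 := by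
  obtain ⟨⟨-, htr⟩, v, rfl⟩ := h
  have hspec : nonzeroSpectrum (vecMulVec v (star v)) =
      nonzeroSpectrum (diagonal fun _ : Unit => ((1 : ℝ) : ℂ)) := by
    rw [vecMulVec_eq Unit, nonzeroSpectrum_mul_comm]
    congr 1
    rw [trace_vecMulVec] at htr
    ext i j
    simp [Matrix.mul_apply, ← htr, dotProduct, mul_comm]
  have h1 : renyiEntropy α (vecMulVec v (star v)) =
      renyiEntropy α (diagonal fun _ : Unit => ((1 : ℝ) : ℂ)) := by
    rw [renyiEntropy, hspec, renyiEntropy]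
  rw [h1, renyiEntropy_diagonal]
  simp [familyEntropy, powOrZero]

end Entropy

/-! ### Majorization for weighted Kraus families -/

section Kraus

variable {S a : Type*} [Fintype S] [Fintype a] [DecidableEq a]

/-- Jensen with uniform weights: for a fixed total, the equal distribution maximizes a concave sum.
-/
theorem sum_concave_le_card_mul {ι : Type*} [Fintype ι] [Nonempty ι] {f : ℝ → ℝ}
    (hf : ConcaveOn ℝ (Set.Ici 0) f) {g : ι → ℝ} (hg : ∀ c, 0 ≤ g c) :
    ∑ c, f (g c) ≤ ∑ _c : ι, f ((∑ c, g c) / Fintype.card ι) := by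
  have hpos : (0 : ℝ) < Fintype.card ι := by exact_mod_cast Fintype.card_pos
  have h := hf.le_map_sum (t := Finset.univ) (w := fun _ : ι => ((Fintype.card ι : ℝ))⁻¹) (p := g)
    (fun _ _ => (inv_pos.mpr hpos).le) (by simp [hpos.ne']) (fun c _ => hg c)
  simp only [smul_eq_mul, ← Finset.mul_sum] at h
  rw [Finset.sum_const, Finset.card_univ, nsmul_eq_mul, div_eq_inv_mul]
  rwa [inv_mul_le_iff₀ hpos] at h

theorem conjTranspose_mul_self_apply {m n : Type*} [Fintype m] (A : Matrix m n ℂ) (l : n) :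
    (Aᴴ * A) l l = ((∑ y, Complex.normSq (A y l) : ℝ) : ℂ) := by
  rw [Matrix.mul_apply]
  push_cast
  simp only [conjTranspose_apply, Complex.normSq_eq_conj_mul_self, Complex.star_def]

/-- The output of a family of weighted Kraus operators, each block of which is isometric in its
first index, majorizes the product of the weights with the spectrum of the input. -/
theorem sum_map_nonzeroSpectrum_kraus_le {Γ : S → Type*} [∀ s, Fintype (Γ s)]
    {w : S → ℝ} (hw : ∀ s, 0 ≤ w s) {M : ∀ s, Γ s → Γ s → Matrix a a ℂ}
    (hM : ∀ s k, ∑ c, (M s c k)ᴴ * M s c k = 1) {ρ N : Matrix a a ℂ} (hρ : ρ.PosSemidef)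
    (hN : N = ∑ s, ∑ k, ∑ c, (w s : ℂ) • (M s c k * ρ * (M s c k)ᴴ)) {f : ℝ → ℝ}
    (hf : ConcaveOn ℝ (Set.Ici 0) f) (hf0 : f 0 = 0) :
    ((nonzeroSpectrum N).map f).sum ≤
      ∑ s, ∑ _k : Γ s, ∑ _c : Γ s, ∑ l,
        f (w s / Fintype.card (Γ s) * hρ.isHermitian.eigenvalues l) := by
  classical
  set V : Matrix a a ℂ := hρ.isHermitian.eigenvectorUnitary.1 with hVdef
  have hV : V ∈ unitaryGroup a ℂ := (hρ.isHermitian.eigenvectorUnitary).2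
  set r : a → ℝ := hρ.isHermitian.eigenvalues with hr
  have hr0 : ∀ l, 0 ≤ r l := hρ.eigenvalues_nonneg
  have hρV : ρ = V * diagonal (fun l => (r l : ℂ)) * Vᴴ := by
    conv_lhs => rw [hρ.isHermitian.spectral_theorem]
    rfl
  -- The columns of `T` are the images of the eigenvectors of `ρ` under all Kraus operators, scaled
  -- by the square roots of the weights, so that `N = T Tᴴ`. Schur's theorem is applied to the Gram
  -- matrix `Tᴴ T`, whose diagonal consists of the squared norms of these columns.
  obtain ⟨T, hT⟩ : ∃ T : Matrix a (Σ s, Γ s × Γ s × a) ℂ, ∀ y s k c l,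
      T y ⟨s, k, c, l⟩ = ((√(w s * r l) : ℝ) : ℂ) * (M s c k * V) y l :=
    ⟨fun y x => ((√(w x.1 * r x.2.2.2) : ℝ) : ℂ) * (M x.1 x.2.2.1 x.2.1 * V) y x.2.2.2,
      fun _ _ _ _ _ => rfl⟩
  have hsq : ∀ s l, ((√(w s * r l) : ℝ) : ℂ) * ((√(w s * r l) : ℝ) : ℂ) = (w s : ℂ) * r l := by
    intro s l
    rw [← Complex.ofReal_mul, Real.mul_self_sqrt (mul_nonneg (hw s) (hr0 l)), Complex.ofReal_mul]
  have hTT : T * Tᴴ = N := by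
    rw [hN]
    ext y y'
    rw [Matrix.mul_apply, Fintype.sum_sigma]
    simp only [Matrix.sum_apply, Fintype.sum_prod_type]
    refine Finset.sum_congr rfl fun s _ => Finset.sum_congr rfl fun k _ =>
      Finset.sum_congr rfl fun c _ => ?_
    have e : M s c k * ρ * (M s c k)ᴴ =
        (M s c k * V) * diagonal (fun l => (r l : ℂ)) * (M s c k * V)ᴴ := by
      rw [hρV, conjTranspose_mul]
      simp only [Matrix.mul_assoc]
    rw [Matrix.smul_apply, e, Matrix.mul_apply, Finset.smul_sum]
    refine Finset.sum_congr rfl fun l _ => ?_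
    simp only [hT, conjTranspose_apply, star_mul', mul_diagonal, smul_eq_mul, Complex.star_def,
      Complex.conj_ofReal]
    linear_combination ((M s c k * V) y l * (starRingEnd ℂ) ((M s c k * V) y' l)) * hsq s l
  have hG : (Tᴴ * T).PosSemidef := posSemidef_conjTranspose_mul_self T
  set g : ∀ s, Γ s → Γ s → a → ℝ := fun s k c l =>
    w s * r l * ∑ y, Complex.normSq ((M s c k * V) y l) with hg
  have hdiag : ∀ s k c l, ((Tᴴ * T) ⟨s, k, c, l⟩ ⟨s, k, c, l⟩).re = g s k c l := by
    intro s k c l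
    rw [Matrix.mul_apply, Complex.re_sum]
    simp only [hg, Finset.mul_sum]
    refine Finset.sum_congr rfl fun y _ => ?_
    have : (Tᴴ ⟨s, k, c, l⟩ y * T y ⟨s, k, c, l⟩) =
        ((w s * r l * Complex.normSq ((M s c k * V) y l) : ℝ) : ℂ) := by
      simp only [hT, conjTranspose_apply, star_mul', Complex.star_def, Complex.conj_ofReal]
      push_cast
      rw [Complex.normSq_eq_conj_mul_self]
      linear_combination ((M s c k * V) y l * (starRingEnd ℂ) ((M s c k * V) y l)) * hsq s l
    rw [this, Complex.ofReal_re]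
  -- Isometry in the index `c` fixes the total of the diagonal entries over `c`. Jensen then
  -- replaces them by `|Γ s|` equal parts.
  have hsum : ∀ s k l, ∑ c, g s k c l = w s * r l := by
    intro s k l
    have h1 : ∑ c, (M s c k * V)ᴴ * (M s c k * V) = 1 := by
      have : ∀ c, (M s c k * V)ᴴ * (M s c k * V) = Vᴴ * ((M s c k)ᴴ * M s c k) * V := fun c => by
        simp only [conjTranspose_mul, Matrix.mul_assoc]
      simp only [this, ← Finset.mul_sum, ← Finset.sum_mul, hM, Matrix.mul_one]
      exact mem_unitaryGroup_iff'.mp hV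
    have h2 : ∑ c, ∑ y, Complex.normSq ((M s c k * V) y l) = 1 := by
      have h3 := congrFun (congrFun h1 l) l
      rw [Matrix.sum_apply] at h3
      simp only [conjTranspose_mul_self_apply, one_apply_eq] at h3
      exact_mod_cast h3
    simp only [hg, ← Finset.mul_sum, h2, mul_one]
  rw [← hTT, nonzeroSpectrum_mul_comm, sum_map_nonzeroSpectrum hG.isHermitian hf0]
  refine (sum_eigenvalues_le_sum_diag hG hf).trans ?_
  rw [Fintype.sum_sigma]
  refine Finset.sum_le_sum fun s _ => ?_
  simp only [Fintype.sum_prod_type, hdiag]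
  refine Finset.sum_le_sum fun k _ => ?_
  rw [Finset.sum_comm, Finset.sum_comm (s := (Finset.univ : Finset (Γ s)))]
  refine Finset.sum_le_sum fun l _ => ?_
  have : Nonempty (Γ s) := ⟨k⟩
  refine (sum_concave_le_card_mul hf (g := fun c => g s k c l) fun c => ?_).trans_eq ?_
  · exact mul_nonneg (mul_nonneg (hw s) (hr0 l))
      (Finset.sum_nonneg fun y _ => Complex.normSq_nonneg _)
  · rw [hsum, mul_div_right_comm]

end Kraus

/-! ### Projections and commutants -/

section Commutant

variable {a b : Type*} [Fintype a] [Fintype b] [DecidableEq a] [DecidableEq b]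

theorem _root_.Matrix.IsHermitian.eq_conj_diagonal {M : Matrix a a ℂ} (hM : M.IsHermitian) :
    M = hM.eigenvectorUnitary.1 * diagonal (fun l => (hM.eigenvalues l : ℂ)) *
      (hM.eigenvectorUnitary.1)ᴴ := by
  conv_lhs => rw [hM.spectral_theorem]
  rfl

/-- A projection is `J Jᴴ` for an isometry `J` from a space of dimension its rank. -/
theorem exists_isometry_of_isStarProjection {P : Matrix a a ℂ} (hP : IsStarProjection P) :
    ∃ J : Matrix a (Fin P.rank) ℂ, Jᴴ * J = 1 ∧ J * Jᴴ = P := by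
  have hH : P.IsHermitian := hP.isSelfAdjoint
  set V : Matrix a a ℂ := hH.eigenvectorUnitary.1 with hVdef
  have hV : V ∈ unitaryGroup a ℂ := (hH.eigenvectorUnitary).2
  have hVV : Vᴴ * V = 1 := mem_unitaryGroup_iff'.mp hV
  have hPV : P = V * diagonal (fun l => (hH.eigenvalues l : ℂ)) * Vᴴ := hH.eq_conj_diagonal
  have hD : Vᴴ * P * V = diagonal (fun l => (hH.eigenvalues l : ℂ)) := by
    conv_lhs => rw [hPV]
    calc Vᴴ * (V * diagonal (fun l => (hH.eigenvalues l : ℂ)) * Vᴴ) * V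
        = (Vᴴ * V) * diagonal (fun l => (hH.eigenvalues l : ℂ)) * (Vᴴ * V) := by
          simp only [Matrix.mul_assoc]
      _ = _ := by rw [hVV, Matrix.one_mul, Matrix.mul_one]
  have hidem : ∀ l, (hH.eigenvalues l : ℂ) * hH.eigenvalues l = hH.eigenvalues l := by
    have h2 : (Vᴴ * P * V) * (Vᴴ * P * V) = Vᴴ * P * V := by
      have hVV' : V * Vᴴ = 1 := mem_unitaryGroup_iff.mp hV
      calc (Vᴴ * P * V) * (Vᴴ * P * V) = Vᴴ * P * (V * Vᴴ) * P * V := by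
            simp only [Matrix.mul_assoc]
        _ = Vᴴ * (P * P) * V := by rw [hVV', Matrix.mul_one, Matrix.mul_assoc Vᴴ P P]
        _ = _ := by rw [hP.isIdempotentElem.eq]
    intro l
    rw [hD, diagonal_mul_diagonal] at h2
    have := congrFun (congrFun h2 l) l
    simpa using this
  let e : Fin P.rank ≃ {i // hH.eigenvalues i ≠ 0} :=
    (Fintype.equivFinOfCardEq hH.rank_eq_card_non_zero_eigs.symm).symm
  refine ⟨V.submatrix id fun k => (e k).1, ?_, ?_⟩
  · ext k k'
    have := congrFun (congrFun hVV (e k)) (e k')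
    rw [Matrix.mul_apply] at this ⊢
    refine Eq.trans this ?_
    simp [Matrix.one_apply, Subtype.coe_inj]
  · ext x x'
    rw [hH.apply_eq_sum, Matrix.mul_apply]
    change ∑ k, V x (e k) * star (V x' (e k)) = ∑ y, V x y * hH.eigenvalues y * star (V x' y)
    rw [e.sum_comp (fun i => V x i * star (V x' i)),
      ← Finset.sum_filter_add_sum_filter_not Finset.univ (fun i => hH.eigenvalues i ≠ 0),
      Finset.sum_eq_zero (s := Finset.univ.filter fun i => ¬ hH.eigenvalues i ≠ 0), add_zero,
      ← Finset.sum_subtype_eq_sum_filter]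
    · refine Finset.sum_congr (by ext; simp) fun i _ => ?_
      have hi : (hH.eigenvalues i : ℂ) = 1 :=
        mul_right_cancel₀ (Complex.ofReal_ne_zero.mpr i.2) ((hidem i).trans (one_mul _).symm)
      rw [hi, mul_one]
    · intro i hi
      have : hH.eigenvalues i = 0 := by simpa using hi
      simp [this]

theorem trace_eq_rank_of_isStarProjection {P : Matrix a a ℂ} (hP : IsStarProjection P) :
    P.trace = P.rank := by
  obtain ⟨J, h1, h2⟩ := exists_isometry_of_isStarProjection hP
  have : (J * Jᴴ).trace = P.rank := by
    rw [trace_mul_comm, h1, trace_one, Fintype.card_fin]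
  rwa [h2] at this

theorem rank_ne_zero_of_isStarProjection {P : Matrix a a ℂ} (hP : IsStarProjection P)
    (h0 : P ≠ 0) : P.rank ≠ 0 := by
  obtain ⟨J, -, h2⟩ := exists_isometry_of_isStarProjection hP
  intro h
  have : IsEmpty (Fin P.rank) := by
    rw [h]
    infer_instance
  apply h0
  rw [← h2]
  ext i j
  simp [Matrix.mul_apply]

/-- The algebra of operators of the first system that commute with `σ`. -/
def localCommutant (σ : Matrix (a × b) (a × b) ℂ) : Subalgebra ℂ (Matrix a a ℂ) where
  carrier := {Z | Commute (Z ⊗ₖ (1 : Matrix b b ℂ)) σ}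
  mul_mem' := by
    intro x y hx hy
    have : (x * y) ⊗ₖ (1 : Matrix b b ℂ) = (x ⊗ₖ 1) * (y ⊗ₖ 1) := by
      rw [← mul_kronecker_mul, one_mul]
    simp only [Set.mem_ofPred_eq, this] at *
    exact hx.mul_left hy
  add_mem' := by
    intro x y hx hy
    simp only [Set.mem_ofPred_eq, add_kronecker] at *
    exact hx.add_left hy
  algebraMap_mem' r := by
    simp only [Set.mem_ofPred_eq, Algebra.algebraMap_eq_smul_one, smul_kronecker,
      one_kronecker_one]
    exact (Commute.one_left σ).smul_left r

theorem mem_localCommutant {σ : Matrix (a × b) (a × b) ℂ} {Z : Matrix a a ℂ} :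
    Z ∈ localCommutant σ ↔ Commute (Z ⊗ₖ (1 : Matrix b b ℂ)) σ :=
  Iff.rfl

theorem conjTranspose_mem_localCommutant {σ : Matrix (a × b) (a × b) ℂ} (hσ : σ.IsHermitian)
    {Z : Matrix a a ℂ} (hZ : Z ∈ localCommutant σ) : Zᴴ ∈ localCommutant σ := by
  rw [mem_localCommutant] at *
  have h := congrArg conjTranspose hZ.eq
  rw [conjTranspose_mul, conjTranspose_mul, hσ.eq, conjTranspose_kronecker,
    conjTranspose_one] at h
  exact h.symm

/-- An operator commuting with `σ` has spectral projections that commute with `σ`. This matters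
because the conditions `typeI` and `maximal` of an essential decomposition speak only of
projections. -/
theorem hermitian_mem_of_projections {σ : Matrix (a × b) (a × b) ℂ}
    {p : Submodule ℂ (Matrix a a ℂ)}
    (hp : ∀ Q, IsStarProjection Q → Q ∈ localCommutant σ → Q ∈ p)
    {H : Matrix a a ℂ} (hH : H.IsHermitian) (hHσ : H ∈ localCommutant σ) : H ∈ p := by
  set V : Matrix a a ℂ := hH.eigenvectorUnitary.1 with hVdef
  have hV : V ∈ unitaryGroup a ℂ := (hH.eigenvectorUnitary).2
  have hVV : Vᴴ * V = 1 := mem_unitaryGroup_iff'.mp hV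
  have hVV' : V * Vᴴ = 1 := mem_unitaryGroup_iff.mp hV
  set W : Matrix (a × b) (a × b) ℂ := V ⊗ₖ (1 : Matrix b b ℂ) with hW
  have hWW : Wᴴ * W = 1 := by
    rw [hW, conjTranspose_kronecker, ← mul_kronecker_mul, hVV, conjTranspose_one, one_mul,
      one_kronecker_one]
  have hWW' : W * Wᴴ = 1 := by
    rw [hW, conjTranspose_kronecker, ← mul_kronecker_mul, hVV', conjTranspose_one, one_mul,
      one_kronecker_one]
  have hconj : ∀ g : a → ℂ, (V * diagonal g * Vᴴ) ∈ localCommutant σ ↔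
      ∀ x y, g x.1 * (Wᴴ * σ * W) x y = (Wᴴ * σ * W) x y * g y.1 := by
    intro g
    have e : (V * diagonal g * Vᴴ) ⊗ₖ (1 : Matrix b b ℂ) =
        W * diagonal (fun x : a × b => g x.1) * Wᴴ := by
      have : diagonal (fun x : a × b => g x.1) = diagonal g ⊗ₖ (1 : Matrix b b ℂ) := by
        rw [← diagonal_one, diagonal_kronecker_diagonal]
        simp
      rw [this, hW, conjTranspose_kronecker, conjTranspose_one, ← mul_kronecker_mul,
        ← mul_kronecker_mul, one_mul, one_mul]
    have hiff : Commute (W * diagonal (fun x : a × b => g x.1) * Wᴴ) σ ↔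
        diagonal (fun x : a × b => g x.1) * (Wᴴ * σ * W) =
          (Wᴴ * σ * W) * diagonal (fun x : a × b => g x.1) := by
      constructor
      · intro h
        calc diagonal (fun x : a × b => g x.1) * (Wᴴ * σ * W)
            = (Wᴴ * W) * diagonal (fun x : a × b => g x.1) * (Wᴴ * σ * W) := by
              rw [hWW, Matrix.one_mul]
          _ = Wᴴ * ((W * diagonal (fun x : a × b => g x.1) * Wᴴ) * σ) * W := by
              simp only [Matrix.mul_assoc]
          _ = Wᴴ * (σ * (W * diagonal (fun x : a × b => g x.1) * Wᴴ)) * W := by rw [h.eq]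
          _ = (Wᴴ * σ * W) * diagonal (fun x : a × b => g x.1) * (Wᴴ * W) := by
              simp only [Matrix.mul_assoc]
          _ = _ := by rw [hWW, Matrix.mul_one]
      · intro h
        calc (W * diagonal (fun x : a × b => g x.1) * Wᴴ) * σ
            = (W * diagonal (fun x : a × b => g x.1) * Wᴴ) * σ * (W * Wᴴ) := by
              rw [hWW', Matrix.mul_one]
          _ = W * (diagonal (fun x : a × b => g x.1) * (Wᴴ * σ * W)) * Wᴴ := by
              simp only [Matrix.mul_assoc]
          _ = W * ((Wᴴ * σ * W) * diagonal (fun x : a × b => g x.1)) * Wᴴ := by rw [h]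
          _ = (W * Wᴴ) * σ * (W * diagonal (fun x : a × b => g x.1) * Wᴴ) := by
              simp only [Matrix.mul_assoc]
          _ = _ := by rw [hWW', Matrix.one_mul]
    rw [mem_localCommutant, e, hiff, ← Matrix.ext_iff]
    simp only [diagonal_mul, mul_diagonal]
  have hHV : H = V * diagonal (fun l => (hH.eigenvalues l : ℂ)) * Vᴴ := hH.eq_conj_diagonal
  rw [hHV, hconj] at hHσ
  let Q : ℝ → Matrix a a ℂ := fun t =>
    V * diagonal (fun l => if hH.eigenvalues l = t then (1 : ℂ) else 0) * Vᴴ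
  have hQ : ∀ t, Q t ∈ p := by
    intro t
    refine hp _ ⟨?_, ?_⟩ ?_
    · change Q t * Q t = Q t
      calc Q t * Q t = V * diagonal (fun l => if hH.eigenvalues l = t then (1 : ℂ) else 0) *
            (Vᴴ * V) * diagonal (fun l => if hH.eigenvalues l = t then (1 : ℂ) else 0) * Vᴴ := by
            simp only [Q, Matrix.mul_assoc]
        _ = Q t := by
            rw [hVV, Matrix.mul_one, Matrix.mul_assoc V, diagonal_mul_diagonal]
            simp only [Q, mul_ite, mul_one, mul_zero]
            congr 3
            ext l
            split_ifs <;> rfl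
    · change (Q t)ᴴ = Q t
      simp only [Q, conjTranspose_mul, conjTranspose_conjTranspose, diagonal_conjTranspose,
        Matrix.mul_assoc]
      congr 3
      ext l
      simp only [Pi.star_apply]
      split_ifs <;> simp
    · rw [hconj]
      intro x y
      -- In an eigenbasis of `H`, commutation says that the entries of the conjugated `σ` vanish
      -- between different eigenvalues. This property passes to any function of the eigenvalues.
      by_cases h0 : (Wᴴ * σ * W) x y = 0
      · simp [h0]
      · have h := hHσ x y
        rw [mul_comm] at h
        have h' : hH.eigenvalues x.1 = hH.eigenvalues y.1 := by
          exact_mod_cast mul_left_cancel₀ h0 h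
        rw [h', mul_comm]
  have hsum : H = ∑ t ∈ Finset.univ.image hH.eigenvalues, (t : ℂ) • Q t := by
    conv_lhs => rw [hHV]
    have : diagonal (fun l => (hH.eigenvalues l : ℂ)) =
        ∑ t ∈ Finset.univ.image hH.eigenvalues,
          (t : ℂ) • diagonal (fun l => if hH.eigenvalues l = t then (1 : ℂ) else 0) := by
      ext x y
      rw [Matrix.sum_apply]
      by_cases hxy : x = y
      · subst hxy
        simp
      · simp [hxy]
    rw [this, Matrix.mul_sum, Matrix.sum_mul]
    simp only [Matrix.mul_smul, Matrix.smul_mul, Q]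
  rw [hsum]
  exact p.sum_mem fun t _ => p.smul_mem _ (hQ t)

/-- The local commutant of a Hermitian operator is spanned by its projections. -/
theorem mem_of_projections_mem {σ : Matrix (a × b) (a × b) ℂ} (hσ : σ.IsHermitian)
    {p : Submodule ℂ (Matrix a a ℂ)}
    (hp : ∀ Q, IsStarProjection Q → Q ∈ localCommutant σ → Q ∈ p)
    {Z : Matrix a a ℂ} (hZ : Z ∈ localCommutant σ) : Z ∈ p := by
  have hZ' := conjTranspose_mem_localCommutant hσ hZ
  have h1 : (Z + Zᴴ) ∈ p := by
    refine hermitian_mem_of_projections hp ?_ (add_mem hZ hZ')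
    rw [IsHermitian, conjTranspose_add, conjTranspose_conjTranspose, add_comm]
  have h2 : (Complex.I • (Z - Zᴴ)) ∈ p := by
    refine hermitian_mem_of_projections hp ?_ (Subalgebra.smul_mem _ (sub_mem hZ hZ') _)
    rw [IsHermitian, conjTranspose_smul, conjTranspose_sub, conjTranspose_conjTranspose]
    simp only [Complex.star_def, Complex.conj_I, neg_smul, ← smul_neg, neg_sub]
  have : Z = (1 / 2 : ℂ) • ((Z + Zᴴ) - Complex.I • (Complex.I • (Z - Zᴴ))) := by
    rw [smul_smul, Complex.I_mul_I, neg_one_smul, sub_neg_eq_add, add_add_sub_cancel, ← two_smul ℂ,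
      smul_smul]
    norm_num
  rw [this]
  exact p.smul_mem _ (p.sub_mem h1 (p.smul_mem _ h2))

end Commutant

/-! ### The commutant in terms of an essential decomposition -/

namespace IsEssentialDecomposition

variable {a b ι : Type*} [Fintype a] [Fintype b] [Fintype ι]
  [DecidableEq a] [DecidableEq b]
  {σ : Matrix (a × b) (a × b) ℂ} {P : ι → Matrix a a ℂ} {t : ι → SectorType}

theorem mul_self (h : IsEssentialDecomposition σ P t) (i : ι) : P i * P i = P i :=
  (h.isStarProjection i).isIdempotentElem.eq

theorem conjTranspose_eq (h : IsEssentialDecomposition σ P t) (i : ι) : (P i)ᴴ = P i :=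
  (h.isStarProjection i).isSelfAdjoint

theorem mem_localCommutant (h : IsEssentialDecomposition σ P t) (i : ι) :
    P i ∈ localCommutant σ :=
  h.commute i

/-- Condition 3 in contrapositive form gives this for projections, and they span the commutant. -/
theorem commute_of_mem (h : IsEssentialDecomposition σ P t) (hσ : σ.IsHermitian) (i : ι)
    {Z : Matrix a a ℂ} (hZ : Z ∈ localCommutant σ) : Commute Z (P i) := by
  let p : Submodule ℂ (Matrix a a ℂ) :=
    { carrier := {Z | Commute Z (P i)}
      zero_mem' := Commute.zero_left _
      add_mem' := fun hx hy => Commute.add_left hx hy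
      smul_mem' := fun c _ hx => Commute.smul_left hx c }
  refine mem_of_projections_mem (p := p) hσ (fun Q hQ hQσ => ?_) hZ
  by_contra hne
  exact h.maximal Q hQ ⟨i, hne⟩ hQσ

theorem compress_eq (h : IsEssentialDecomposition σ P t) (i : ι) :
    compress (P i) σ = (P i ⊗ₖ (1 : Matrix b b ℂ)) * σ := by
  rw [compress, Matrix.mul_assoc, ← (h.commute i).eq, ← Matrix.mul_assoc, ← mul_kronecker_mul,
    h.mul_self, one_mul]

/-- A projection `Q` of the commutant that is not scalar on the sector would split `P i` into the
nonzero parts `Q P i` and `P i - Q P i`, a measurement that leaves the sector unperturbed. Type I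
forbids this. -/
theorem exists_mul_eq_smul_of_typeI (h : IsEssentialDecomposition σ P t) (hσ : σ.IsHermitian)
    {i : ι} (hi : t i = SectorType.I) {Z : Matrix a a ℂ} (hZ : Z ∈ localCommutant σ) :
    ∃ z : ℂ, Z * P i = z • P i := by
  let p : Submodule ℂ (Matrix a a ℂ) :=
    { carrier := {Z | ∃ z : ℂ, Z * P i = z • P i}
      zero_mem' := ⟨0, by simp⟩
      add_mem' := by
        rintro x y ⟨z, hz⟩ ⟨z', hz'⟩
        exact ⟨z + z', by rw [add_mul, hz, hz', add_smul]⟩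
      smul_mem' := by
        rintro c x ⟨z, hz⟩
        exact ⟨c * z, by rw [smul_mul_assoc, hz, smul_smul]⟩ }
  refine mem_of_projections_mem (p := p) hσ (fun Q hQ hQσ => ?_) hZ
  by_contra hne
  have hcomm := h.commute_of_mem hσ i hQσ
  have hne0 : Q * P i ≠ 0 := fun h0 => hne ⟨0, by rw [h0, zero_smul]⟩
  have hneP : P i - Q * P i ≠ 0 := fun h0 => hne ⟨1, by rw [one_smul, ← sub_eq_zero.mp h0]⟩
  have hQQ : Q * Q = Q := hQ.isIdempotentElem.eq
  have hPP := h.mul_self i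
  have hR1 : (Q * P i) * (Q * P i) = Q * P i := by
    rw [← Matrix.mul_assoc, Matrix.mul_assoc Q, ← hcomm.eq, ← Matrix.mul_assoc, hQQ,
      Matrix.mul_assoc, hPP]
  have hPR : P i * (Q * P i) = Q * P i := by
    rw [← Matrix.mul_assoc, ← hcomm.eq, Matrix.mul_assoc, hPP]
  have hRP : (Q * P i) * P i = Q * P i := by rw [Matrix.mul_assoc, hPP]
  have hRs : (Q * P i)ᴴ = Q * P i := by
    rw [conjTranspose_mul, h.conjTranspose_eq, hcomm.eq]
    congr 1
    exact hQ.isSelfAdjoint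
  have hRσ : Q * P i ∈ localCommutant σ := mul_mem hQσ (h.mem_localCommutant i)
  have hcompress : ∀ R : Matrix a a ℂ, R ∈ localCommutant σ → R * P i = R → R * R = R →
      compress R (compress (P i) σ) = (R ⊗ₖ (1 : Matrix b b ℂ)) * σ := by
    intro R hR h1 h2
    rw [h.compress_eq, compress, ← Matrix.mul_assoc, ← mul_kronecker_mul, h1, one_mul,
      Matrix.mul_assoc, ← (DelocalizedCatalysis.mem_localCommutant.mp hR).eq, ← Matrix.mul_assoc,
      ← mul_kronecker_mul, h2, one_mul]
  have hS1 : (P i - Q * P i) * (P i - Q * P i) = P i - Q * P i := by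
    rw [sub_mul, mul_sub, mul_sub, hPP, hPR, hRP, hR1, sub_self, sub_zero]
  refine h.typeI i hi ⟨2, ![Q * P i, P i - Q * P i], one_lt_two, ?_, ?_, ?_, ?_⟩
  · intro k
    fin_cases k
    · exact ⟨⟨hR1, hRs⟩, hne0⟩
    · refine ⟨⟨hS1, ?_⟩, hneP⟩
      change (P i - Q * P i)ᴴ = P i - Q * P i
      rw [conjTranspose_sub, hRs, h.conjTranspose_eq]
  · intro k l hkl
    fin_cases k <;> fin_cases l
    · exact absurd rfl hkl
    · change (Q * P i) * (P i - Q * P i) = 0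
      rw [mul_sub, hRP, hR1, sub_self]
    · change (P i - Q * P i) * (Q * P i) = 0
      rw [sub_mul, hPR, hR1, sub_self]
    · exact absurd rfl hkl
  · simp [Fin.sum_univ_two]
  · rw [Fin.sum_univ_two]
    change compress (P i) σ = compress (Q * P i) (compress (P i) σ) +
      compress (P i - Q * P i) (compress (P i) σ)
    rw [hcompress _ hRσ hRP hR1, hcompress _ (sub_mem (h.mem_localCommutant i) hRσ)
      (by rw [sub_mul, hPP, hRP]) hS1, ← add_mul, ← add_kronecker, add_sub_cancel, h.compress_eq]

/-- Inside the sector, `σ` is a multiple of `P i ⊗ ω`, and `P i` is the identity for operators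
supported there. -/
theorem mem_localCommutant_of_typeII (h : IsEssentialDecomposition σ P t)
    {i : ι} (hi : t i = SectorType.II) {Z : Matrix a a ℂ} (h1 : P i * Z = Z) (h2 : Z * P i = Z) :
    Z ∈ localCommutant σ := by
  obtain ⟨ω, -, hω⟩ := h.typeII i hi
  set c := (compress (P i) σ).trace
  rw [h.compress_eq] at hω
  rw [DelocalizedCatalysis.mem_localCommutant]
  have e1 : Z ⊗ₖ (1 : Matrix b b ℂ) = (Z ⊗ₖ 1) * (P i ⊗ₖ 1) := by
    rw [← mul_kronecker_mul, h2, one_mul]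
  have e2 : Z ⊗ₖ (1 : Matrix b b ℂ) = (P i ⊗ₖ 1) * (Z ⊗ₖ 1) := by
    rw [← mul_kronecker_mul, h1, one_mul]
  change _ * σ = σ * _
  conv_lhs => rw [e1, Matrix.mul_assoc, hω]
  conv_rhs => rw [e2, ← Matrix.mul_assoc, ← (h.commute i).eq, hω]
  simp only [Matrix.mul_smul, Matrix.smul_mul, smul_kronecker, ← mul_kronecker_mul, h1, h2,
    one_mul, mul_one]

/-- On the commutant, the state is maximally mixed in every sector. -/
theorem trace_sector (h : IsEssentialDecomposition σ P t) (hσ : σ.IsHermitian) (i : ι)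
    {Z : Matrix a a ℂ} (hZ : Z ∈ localCommutant σ) (W : Matrix b b ℂ) :
    (((Z * P i) ⊗ₖ W) * σ).trace =
      (Z * P i).trace / (P i).rank * ((P i ⊗ₖ W) * σ).trace := by
  have hrank : ((P i).rank : ℂ) ≠ 0 :=
    Nat.cast_ne_zero.mpr (rank_ne_zero_of_isStarProjection (h.isStarProjection i) (h.ne_zero i))
  have htr := trace_eq_rank_of_isStarProjection (h.isStarProjection i)
  cases hi : t i with
  | I =>
    obtain ⟨z, hz⟩ := h.exists_mul_eq_smul_of_typeI hσ hi hZ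
    rw [hz, smul_kronecker, Matrix.smul_mul, trace_smul, trace_smul, htr, smul_eq_mul, smul_eq_mul,
      mul_div_cancel_right₀ _ hrank]
  | II =>
    obtain ⟨ω, -, hω⟩ := h.typeII i hi
    set c := (compress (P i) σ).trace
    rw [h.compress_eq] at hω
    have key : ∀ Y : Matrix a a ℂ, Y * P i = Y →
        ((Y ⊗ₖ W) * σ).trace = c * (((P i).rank : ℂ)⁻¹ * (Y.trace * (W * ω).trace)) := by
      intro Y hY
      have e : Y ⊗ₖ W = (Y ⊗ₖ W) * (P i ⊗ₖ 1) := by rw [← mul_kronecker_mul, hY, mul_one]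
      rw [e, Matrix.mul_assoc, hω]
      simp only [Matrix.mul_smul, smul_kronecker, ← mul_kronecker_mul, hY, trace_smul,
        trace_kronecker, smul_eq_mul]
    rw [key _ (by rw [Matrix.mul_assoc, h.mul_self]), key _ (h.mul_self i), htr]
    field_simp

end IsEssentialDecomposition

/-! ### Block decomposition with respect to the first system -/

section Blocks

variable {a b : Type*}

/-- The operator `⟨χ| U |φ⟩` on the second system. -/
def block (U : Matrix (a × b) (a × b) ℂ) (χ φ : a) : Matrix b b ℂ :=
  U.submatrix (Prod.mk χ) (Prod.mk φ)

theorem block_apply (U : Matrix (a × b) (a × b) ℂ) (χ φ : a) (x y : b) :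
    block U χ φ x y = U (χ, x) (φ, y) :=
  rfl

theorem block_ext {U V : Matrix (a × b) (a × b) ℂ} (h : ∀ χ φ, block U χ φ = block V χ φ) :
    U = V := by
  ext ⟨χ, x⟩ ⟨φ, y⟩
  exact congrFun (congrFun (h χ φ) x) y

theorem block_conjTranspose (U : Matrix (a × b) (a × b) ℂ) (χ φ : a) :
    block Uᴴ χ φ = (block U φ χ)ᴴ :=
  rfl

theorem block_kronecker (ρ : Matrix a a ℂ) (σ : Matrix b b ℂ) (χ φ : a) :
    block (ρ ⊗ₖ σ) χ φ = ρ χ φ • σ :=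
  rfl

theorem block_one [DecidableEq a] [DecidableEq b] (χ φ : a) :
    block (1 : Matrix (a × b) (a × b) ℂ) χ φ = if χ = φ then 1 else 0 := by
  ext x y
  by_cases h : χ = φ <;> simp [block_apply, Matrix.one_apply, h]

theorem traceRight_apply [Fintype b] (M : Matrix (a × b) (a × b) ℂ) (χ φ : a) :
    traceRight M χ φ = (block M χ φ).trace :=
  rfl

variable [Fintype a]

theorem traceLeft_eq_sum_block (M : Matrix (a × b) (a × b) ℂ) :
    traceLeft M = ∑ χ, block M χ χ := by
  ext x y
  rw [Matrix.sum_apply]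
  rfl

variable [Fintype b]

theorem block_mul (U V : Matrix (a × b) (a × b) ℂ) (χ φ : a) :
    block (U * V) χ φ = ∑ ξ, block U χ ξ * block V ξ φ := by
  ext x y
  simp only [block_apply, Matrix.mul_apply, Matrix.sum_apply, Fintype.sum_prod_type]

theorem trace_eq_sum_block (M : Matrix (a × b) (a × b) ℂ) :
    M.trace = ∑ χ, (block M χ χ).trace := by
  simp only [Matrix.trace, Fintype.sum_prod_type, Matrix.diag_apply, block_apply]

variable [DecidableEq a] [DecidableEq b]

theorem block_mul_one_kronecker (U : Matrix (a × b) (a × b) ℂ) (σ : Matrix b b ℂ) (χ φ : a) :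
    block (U * ((1 : Matrix a a ℂ) ⊗ₖ σ)) χ φ = block U χ φ * σ := by
  rw [block_mul, Finset.sum_eq_single φ]
  · rw [block_kronecker, one_apply_eq, one_smul]
  · intro ξ _ h
    rw [block_kronecker, one_apply_ne h, zero_smul, mul_zero]
  · simp

theorem block_one_kronecker_mul (U : Matrix (a × b) (a × b) ℂ) (σ : Matrix b b ℂ) (χ φ : a) :
    block (((1 : Matrix a a ℂ) ⊗ₖ σ) * U) χ φ = σ * block U χ φ := by
  rw [block_mul, Finset.sum_eq_single χ]
  · rw [block_kronecker, one_apply_eq, one_smul]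
  · intro ξ _ h
    rw [block_kronecker, one_apply_ne h.symm, zero_smul, zero_mul]
  · simp

theorem mem_unitaryGroup_iff_block {U : Matrix (a × b) (a × b) ℂ} :
    U ∈ unitaryGroup (a × b) ℂ ↔
      ∀ φ φ', ∑ χ, (block U χ φ)ᴴ * block U χ φ' = if φ = φ' then 1 else 0 := by
  rw [mem_unitaryGroup_iff', star_eq_conjTranspose]
  constructor
  · intro h φ φ'
    rw [← block_one, ← h, block_mul]
    rfl
  · intro h
    refine block_ext fun φ φ' => ?_
    rw [block_one, ← h, block_mul]
    rfl

theorem sum_block_mul_conjTranspose {U : Matrix (a × b) (a × b) ℂ}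
    (hU : U ∈ unitaryGroup (a × b) ℂ) (χ χ' : a) :
    ∑ φ, block U χ φ * (block U χ' φ)ᴴ = if χ = χ' then 1 else 0 := by
  rw [← block_one, ← mem_unitaryGroup_iff.mp hU, star_eq_conjTranspose, block_mul]
  rfl

/-- If a unitary leaves `σ` invariant when the first system is maximally mixed, all its blocks
commute with `σ`. -/
theorem block_commute_of_traceLeft {U : Matrix (a × b) (a × b) ℂ}
    (hU : U ∈ unitaryGroup (a × b) ℂ) {σ : Matrix b b ℂ} (hσ : σ.IsHermitian)
    (h : traceLeft (U * ((1 : Matrix a a ℂ) ⊗ₖ σ) * Uᴴ) = (Fintype.card a : ℂ) • σ) (χ φ : a) :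
    Commute (block U χ φ) σ := by
  have hUU : Uᴴ * U = 1 := mem_unitaryGroup_iff'.mp hU
  set S : Matrix (a × b) (a × b) ℂ := (1 : Matrix a a ℂ) ⊗ₖ σ with hS
  set Y := U * S * Uᴴ with hY
  have hSs : Sᴴ = S := by rw [hS, conjTranspose_kronecker, conjTranspose_one, hσ.eq]
  have hYs : Yᴴ = Y := by
    rw [hY, conjTranspose_mul, conjTranspose_mul, conjTranspose_conjTranspose, hSs,
      Matrix.mul_assoc]
  -- `Y` and `S` have equal Hilbert–Schmidt norms by unitarity, and invariance of the reduced state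
  -- gives their overlap the same value. Hence `‖Y - S‖² = 0`, so `U` commutes with `1 ⊗ σ`.
  have hYY : (Y * Y).trace = (S * S).trace := by
    calc (Y * Y).trace = (U * (S * (Uᴴ * U) * S * Uᴴ)).trace := by
          simp only [hY, Matrix.mul_assoc]
      _ = (S * S * (Uᴴ * U)).trace := by
          rw [hUU, Matrix.mul_one, trace_mul_comm, Matrix.mul_assoc, hUU]
      _ = _ := by rw [hUU, Matrix.mul_one]
  have hSS : (S * S).trace = Fintype.card a * (σ * σ).trace := by
    rw [hS, ← mul_kronecker_mul, trace_kronecker, one_mul, trace_one]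
  have hYS : (Y * S).trace = Fintype.card a * (σ * σ).trace := by
    rw [trace_eq_sum_block]
    simp only [hS, block_mul_one_kronecker]
    rw [← trace_sum, ← Finset.sum_mul, ← traceLeft_eq_sum_block, h, Matrix.smul_mul, trace_smul,
      smul_eq_mul]
  have hzero : Y - S = 0 := by
    rw [← trace_conjTranspose_mul_self_eq_zero_iff, conjTranspose_sub, hYs, hSs, sub_mul, mul_sub,
      mul_sub, trace_sub, trace_sub, trace_sub, hYY, trace_mul_comm S Y, hYS, hSS]
    ring
  have hcomm : U * S = S * U := by
    calc U * S = Y * U := by rw [hY, Matrix.mul_assoc _ Uᴴ U, hUU, Matrix.mul_one]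
      _ = S * U := by rw [sub_eq_zero.mp hzero]
  have := congrArg (fun M => block M χ φ) hcomm
  simp only [hS, block_mul_one_kronecker, block_one_kronecker_mul] at this
  exact this

end Blocks

/-! ### Joint dynamics in terms of blocks -/

section Pair

variable {a₀ a₁ b₀ b₁ : Type*}

theorem block_pairUnitary (U₀ : Matrix (a₀ × b₀) (a₀ × b₀) ℂ) (U₁ : Matrix (a₁ × b₁) (a₁ × b₁) ℂ)
    (χ φ : a₀ × a₁) :
    block (pairUnitary U₀ U₁) χ φ = block U₀ χ.1 φ.1 ⊗ₖ block U₁ χ.2 φ.2 :=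
  rfl

variable [Fintype a₀] [Fintype a₁] [Fintype b₀] [Fintype b₁]

theorem block_jointOutput (U₀ : Matrix (a₀ × b₀) (a₀ × b₀) ℂ)
    (U₁ : Matrix (a₁ × b₁) (a₁ × b₁) ℂ) (σ : Matrix (b₀ × b₁) (b₀ × b₁) ℂ)
    (ρ : Matrix (a₀ × a₁) (a₀ × a₁) ℂ) (χ χ' : a₀ × a₁) :
    block (jointOutput U₀ U₁ σ ρ) χ χ' = ∑ φ, ∑ φ', ρ φ φ' •
      ((block U₀ χ.1 φ.1 ⊗ₖ block U₁ χ.2 φ.2) * σ *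
        (block U₀ χ'.1 φ'.1 ⊗ₖ block U₁ χ'.2 φ'.2)ᴴ) := by
  rw [jointOutput, block_mul, Finset.sum_comm]
  refine Finset.sum_congr rfl fun φ' _ => ?_
  rw [block_mul, Finset.sum_mul]
  refine Finset.sum_congr rfl fun φ _ => ?_
  rw [block_kronecker, Matrix.mul_smul, Matrix.smul_mul, block_conjTranspose, block_pairUnitary,
    block_pairUnitary]

/-- Cyclicity of the trace shows that the source enters the output only through expectation values
of products `Kᴴ K'` of blocks, one such product on each side. -/
theorem catalyticMap_apply (U₀ : Matrix (a₀ × b₀) (a₀ × b₀) ℂ)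
    (U₁ : Matrix (a₁ × b₁) (a₁ × b₁) ℂ) (σ : Matrix (b₀ × b₁) (b₀ × b₁) ℂ)
    (ρ : Matrix (a₀ × a₁) (a₀ × a₁) ℂ) (χ χ' : a₀ × a₁) :
    catalyticMap U₀ U₁ σ ρ χ χ' = ∑ φ, ∑ φ', ρ φ φ' *
      ((((block U₀ χ'.1 φ'.1)ᴴ * block U₀ χ.1 φ.1) ⊗ₖ
        ((block U₁ χ'.2 φ'.2)ᴴ * block U₁ χ.2 φ.2)) * σ).trace := by
  rw [catalyticMap, traceRight_apply, block_jointOutput, trace_sum]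
  refine Finset.sum_congr rfl fun φ _ => ?_
  rw [trace_sum]
  refine Finset.sum_congr rfl fun φ' _ => ?_
  rw [trace_smul, smul_eq_mul, trace_mul_comm, ← Matrix.mul_assoc, conjTranspose_kronecker,
    ← mul_kronecker_mul]

variable [DecidableEq a₀] [DecidableEq a₁] [DecidableEq b₀] [DecidableEq b₁]

theorem pairUnitary_mem_unitaryGroup {U₀ : Matrix (a₀ × b₀) (a₀ × b₀) ℂ}
    {U₁ : Matrix (a₁ × b₁) (a₁ × b₁) ℂ} (h₀ : U₀ ∈ unitaryGroup (a₀ × b₀) ℂ)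
    (h₁ : U₁ ∈ unitaryGroup (a₁ × b₁) ℂ) :
    pairUnitary U₀ U₁ ∈ unitaryGroup ((a₀ × a₁) × (b₀ × b₁)) ℂ := by
  rw [mem_unitaryGroup_iff_block] at *
  rintro ⟨φ₀, φ₁⟩ ⟨φ₀', φ₁'⟩
  simp only [block_pairUnitary, Fintype.sum_prod_type, conjTranspose_kronecker,
    ← mul_kronecker_mul]
  have : ∀ (f : a₀ → Matrix b₀ b₀ ℂ) (g : a₁ → Matrix b₁ b₁ ℂ),
      ∑ x, ∑ y, f x ⊗ₖ g y = (∑ x, f x) ⊗ₖ (∑ y, g y) := by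
    intro f g
    ext ⟨i, j⟩ ⟨k, l⟩
    simp [Matrix.sum_apply, kroneckerMap_apply, Finset.sum_mul_sum]
  rw [this, h₀, h₁]
  by_cases e₀ : φ₀ = φ₀' <;> by_cases e₁ : φ₁ = φ₁' <;> simp [e₀, e₁]

theorem isState_maximallyMixed [Nonempty a₀] :
    IsState (((Fintype.card a₀ : ℂ))⁻¹ • (1 : Matrix a₀ a₀ ℂ)) := by
  refine ⟨PosSemidef.one.smul ?_, ?_⟩
  · rw [← Complex.ofReal_natCast, ← Complex.ofReal_inv]
    exact Complex.zero_le_real.mpr (by positivity)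
  · rw [trace_smul, trace_one, smul_eq_mul, inv_mul_cancel₀]
    exact Nat.cast_ne_zero.mpr Fintype.card_ne_zero

/-- The maximally mixed input alone suffices: it turns compatibility into the hypothesis of
`block_commute_of_traceLeft`. -/
theorem block_kronecker_commute_of_isCompatible [Nonempty a₀] [Nonempty a₁]
    {U₀ : Matrix (a₀ × b₀) (a₀ × b₀) ℂ} {U₁ : Matrix (a₁ × b₁) (a₁ × b₁) ℂ}
    (h₀ : U₀ ∈ unitaryGroup (a₀ × b₀) ℂ) (h₁ : U₁ ∈ unitaryGroup (a₁ × b₁) ℂ)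
    {σ : Matrix (b₀ × b₁) (b₀ × b₁) ℂ} (hσ : σ.IsHermitian) (h : IsCompatible U₀ U₁ σ)
    (χ₀ φ₀ : a₀) (χ₁ φ₁ : a₁) :
    Commute (block U₀ χ₀ φ₀ ⊗ₖ block U₁ χ₁ φ₁) σ := by
  refine block_commute_of_traceLeft (pairUnitary_mem_unitaryGroup h₀ h₁) hσ ?_ (χ₀, χ₁) (φ₀, φ₁)
  have hstate := h _ (isState_maximallyMixed (a₀ := a₀ × a₁))
  have hne : ((Fintype.card (a₀ × a₁) : ℕ) : ℂ) ≠ 0 := Nat.cast_ne_zero.mpr Fintype.card_ne_zero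
  have e : jointOutput U₀ U₁ σ ((Fintype.card (a₀ × a₁) : ℂ)⁻¹ • 1) =
      ((Fintype.card (a₀ × a₁) : ℕ) : ℂ)⁻¹ •
        (pairUnitary U₀ U₁ * (1 ⊗ₖ σ) * (pairUnitary U₀ U₁)ᴴ) := by
    rw [jointOutput, smul_kronecker, Matrix.mul_smul, Matrix.smul_mul]
  have e2 : ∀ (c : ℂ) (M : Matrix ((a₀ × a₁) × (b₀ × b₁)) ((a₀ × a₁) × (b₀ × b₁)) ℂ),
      traceLeft (c • M) = c • traceLeft M := by
    intro c M
    ext x y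
    simp [traceLeft, Finset.mul_sum]
  rw [e, e2] at hstate
  rw [← hstate, smul_smul, mul_inv_cancel₀ hne, one_smul, hstate]

/-- Compatibility controls only tensor products of blocks of both unitaries. Multiplying one such
product by the adjoint of another and summing over the output index of `U₁` replaces the second
factor by the identity. -/
theorem mem_localCommutant_of_isCompatible_left [Nonempty a₀] [Nonempty a₁]
    {U₀ : Matrix (a₀ × b₀) (a₀ × b₀) ℂ} {U₁ : Matrix (a₁ × b₁) (a₁ × b₁) ℂ}
    (h₀ : U₀ ∈ unitaryGroup (a₀ × b₀) ℂ) (h₁ : U₁ ∈ unitaryGroup (a₁ × b₁) ℂ)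
    {σ : Matrix (b₀ × b₁) (b₀ × b₁) ℂ} (hσ : σ.IsHermitian) (h : IsCompatible U₀ U₁ σ)
    (χ φ χ' φ' : a₀) :
    (block U₀ χ' φ')ᴴ * block U₀ χ φ ∈ localCommutant σ := by
  obtain ⟨φ₁⟩ := ‹Nonempty a₁›
  have e : ((block U₀ χ' φ')ᴴ * block U₀ χ φ) ⊗ₖ (1 : Matrix b₁ b₁ ℂ) =
      ∑ χ₁, (block U₀ χ' φ' ⊗ₖ block U₁ χ₁ φ₁)ᴴ * (block U₀ χ φ ⊗ₖ block U₁ χ₁ φ₁) := by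
    have := mem_unitaryGroup_iff_block.mp h₁ φ₁ φ₁
    rw [if_pos rfl] at this
    rw [← this]
    simp only [conjTranspose_kronecker, ← mul_kronecker_mul]
    ext ⟨i, j⟩ ⟨k, l⟩
    simp [Matrix.sum_apply, kroneckerMap_apply, Finset.mul_sum]
  rw [mem_localCommutant, e]
  refine Commute.sum_left _ _ _ fun χ₁ _ => ?_
  have hne : Nonempty a₁ := ⟨φ₁⟩
  have hc := block_kronecker_commute_of_isCompatible h₀ h₁ hσ h
  refine Commute.mul_left ?_ (hc _ _ _ _)
  have := congrArg conjTranspose (hc χ' φ' χ₁ φ₁).eq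
  rw [conjTranspose_mul, conjTranspose_mul, hσ.eq] at this
  exact this.symm

end Pair

/-! ### Exchanging the two systems -/

section Swap

variable {a b : Type*}

theorem swapState_kronecker (M : Matrix a a ℂ) (N : Matrix b b ℂ) :
    swapState (M ⊗ₖ N) = N ⊗ₖ M := by
  ext x y
  simp [swapState, kroneckerMap_apply, mul_comm]

theorem isHermitian_swapState {σ : Matrix (a × b) (a × b) ℂ} (hσ : σ.IsHermitian) :
    (swapState σ).IsHermitian :=
  hσ.submatrix _

variable [Fintype a] [Fintype b]

theorem swapState_mul (M N : Matrix (a × b) (a × b) ℂ) :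
    swapState (M * N) = swapState M * swapState N :=
  (submatrix_mul_equiv M N Prod.swap (Equiv.prodComm b a) Prod.swap).symm

theorem trace_swapState (M : Matrix (a × b) (a × b) ℂ) : (swapState M).trace = M.trace :=
  (Equiv.prodComm b a).sum_comp (fun x => M x x)

theorem trace_kronecker_mul_swapState (M : Matrix a a ℂ) (N : Matrix b b ℂ)
    (σ : Matrix (a × b) (a × b) ℂ) :
    ((N ⊗ₖ M) * swapState σ).trace = ((M ⊗ₖ N) * σ).trace := by
  rw [← swapState_kronecker, ← swapState_mul, trace_swapState]

variable [DecidableEq a] [DecidableEq b]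

theorem mem_localCommutant_swapState {σ : Matrix (a × b) (a × b) ℂ} {Z : Matrix b b ℂ} :
    Z ∈ localCommutant (swapState σ) ↔ Commute ((1 : Matrix a a ℂ) ⊗ₖ Z) σ := by
  rw [mem_localCommutant, ← swapState_kronecker]
  change _ * _ = _ * _ ↔ _ * _ = _ * _
  rw [← swapState_mul, ← swapState_mul]
  refine ⟨fun h => ?_, fun h => congrArg swapState h⟩
  have := congrArg swapState h
  exact this

theorem mem_localCommutant_of_isCompatible_right {a₀ a₁ b₀ b₁ : Type*} [Fintype a₀] [Fintype a₁]
    [Fintype b₀] [Fintype b₁] [DecidableEq a₀] [DecidableEq a₁] [DecidableEq b₀] [DecidableEq b₁]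
    [Nonempty a₀] [Nonempty a₁]
    {U₀ : Matrix (a₀ × b₀) (a₀ × b₀) ℂ} {U₁ : Matrix (a₁ × b₁) (a₁ × b₁) ℂ}
    (h₀ : U₀ ∈ unitaryGroup (a₀ × b₀) ℂ) (h₁ : U₁ ∈ unitaryGroup (a₁ × b₁) ℂ)
    {σ : Matrix (b₀ × b₁) (b₀ × b₁) ℂ} (hσ : σ.IsHermitian) (h : IsCompatible U₀ U₁ σ)
    (χ φ χ' φ' : a₁) :
    (block U₁ χ' φ')ᴴ * block U₁ χ φ ∈ localCommutant (swapState σ) := by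
  obtain ⟨φ₀⟩ := ‹Nonempty a₀›
  have e : (1 : Matrix b₀ b₀ ℂ) ⊗ₖ ((block U₁ χ' φ')ᴴ * block U₁ χ φ) =
      ∑ χ₀, (block U₀ χ₀ φ₀ ⊗ₖ block U₁ χ' φ')ᴴ * (block U₀ χ₀ φ₀ ⊗ₖ block U₁ χ φ) := by
    have := mem_unitaryGroup_iff_block.mp h₀ φ₀ φ₀
    rw [if_pos rfl] at this
    rw [← this]
    simp only [conjTranspose_kronecker, ← mul_kronecker_mul]
    ext ⟨i, j⟩ ⟨k, l⟩
    simp [Matrix.sum_apply, kroneckerMap_apply, Finset.sum_mul]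
  rw [mem_localCommutant_swapState, e]
  refine Commute.sum_left _ _ _ fun χ₀ _ => ?_
  have hne : Nonempty a₀ := ⟨φ₀⟩
  have hc := block_kronecker_commute_of_isCompatible h₀ h₁ hσ h
  refine Commute.mul_left ?_ (hc _ _ _ _)
  have := congrArg conjTranspose (hc χ₀ φ₀ χ' φ').eq
  rw [conjTranspose_mul, conjTranspose_mul, hσ.eq] at this
  exact this.symm

end Swap

/-! ### Expectation values on the local commutants -/

section Expectation

variable {b₀ b₁ ι₀ ι₁ : Type*} [Fintype b₀] [Fintype b₁] [Fintype ι₀] [Fintype ι₁]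
  [DecidableEq b₀] [DecidableEq b₁]

/-- Both identities are resolved into sectors, and `trace_sector` is applied to one side at a time,
first with `σ` and then with the systems exchanged. The correlations of `σ` survive only in the
classical weights of the pairs of sectors. -/
theorem trace_kronecker_mul_eq_sum {σ : Matrix (b₀ × b₁) (b₀ × b₁) ℂ} (hσ : σ.IsHermitian)
    {P₀ : ι₀ → Matrix b₀ b₀ ℂ} {t₀ : ι₀ → SectorType} (h₀ : IsEssentialDecomposition σ P₀ t₀)
    {P₁ : ι₁ → Matrix b₁ b₁ ℂ} {t₁ : ι₁ → SectorType}
    (h₁ : IsEssentialDecomposition (swapState σ) P₁ t₁)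
    {Z : Matrix b₀ b₀ ℂ} (hZ : Z ∈ localCommutant σ)
    {W : Matrix b₁ b₁ ℂ} (hW : W ∈ localCommutant (swapState σ)) :
    ((Z ⊗ₖ W) * σ).trace = ∑ i, ∑ j, ((P₀ i ⊗ₖ P₁ j) * σ).trace *
      ((Z * P₀ i).trace / (P₀ i).rank) * ((W * P₁ j).trace / (P₁ j).rank) := by
  have e : Z ⊗ₖ W = ∑ i, ∑ j, (Z * P₀ i) ⊗ₖ (W * P₁ j) := by
    conv_lhs => rw [← Matrix.mul_one Z, ← Matrix.mul_one W, ← h₀.sum_eq_one, ← h₁.sum_eq_one]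
    rw [Matrix.mul_sum, Matrix.mul_sum]
    ext ⟨x, y⟩ ⟨x', y'⟩
    simp only [Matrix.sum_apply, kroneckerMap_apply, Finset.sum_mul_sum]
  rw [e, Finset.sum_mul, trace_sum]
  refine Finset.sum_congr rfl fun i _ => ?_
  rw [Finset.sum_mul, trace_sum]
  refine Finset.sum_congr rfl fun j _ => ?_
  rw [h₀.trace_sector hσ i hZ, ← trace_kronecker_mul_swapState,
    h₁.trace_sector (isHermitian_swapState hσ) j hW, trace_kronecker_mul_swapState]
  ring

end Expectation

/-! ### The form of a compatible unitary in one sector -/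

section SectorForm

variable {a b ι : Type*} [Fintype a] [Fintype b] [Fintype ι] [DecidableEq a] [DecidableEq b]
  {U : Matrix (a × b) (a × b) ℂ} {P : Matrix b b ℂ}

/-- An intertwiner between a `*`-closed family and the matrix units has `V Vᴴ` commuting with all
matrix units, hence scalar. The scalar is the squared norm of a nonzero row, so rescaling makes `V`
unitary. -/
theorem conjTranspose_mul_self_eq_one_of_intertwining {V : Matrix a a ℂ} (hV : V ≠ 0)
    {Z : a → a → Matrix a a ℂ} (hZ : ∀ χ' χ, (Z χ' χ)ᴴ = Z χ χ')
    (h : ∀ χ' χ, V * Z χ' χ = single χ' χ 1 * V) :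
    ∃ c : ℂ, (c • V)ᴴ * (c • V) = 1 := by
  have hcomm : V * Vᴴ ∈ Set.range (Matrix.scalar a) := by
    refine mem_range_scalar_of_commute_single fun χ' χ _ => ?_
    have h' := congrArg conjTranspose (h χ χ')
    rw [conjTranspose_mul, conjTranspose_mul, hZ, conjTranspose_single, star_one] at h'
    calc single χ' χ 1 * (V * Vᴴ) = V * (Z χ' χ * Vᴴ) := by
          rw [← Matrix.mul_assoc, ← h, Matrix.mul_assoc]
      _ = V * Vᴴ * single χ' χ 1 := by rw [h', Matrix.mul_assoc]
  obtain ⟨s, hs⟩ := hcomm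
  obtain ⟨x, hx⟩ : ∃ x, V x ≠ 0 := by
    by_contra! h0
    exact hV (funext h0)
  obtain ⟨y, hy⟩ : ∃ y, V x y ≠ 0 := by
    by_contra! h0
    exact hx (funext h0)
  have hsx : s = ((∑ y, Complex.normSq (V x y) : ℝ) : ℂ) := by
    have h1 := congrFun (congrFun hs x) x
    rw [scalar_apply, diagonal_apply_eq] at h1
    have h2 := conjTranspose_mul_self_apply Vᴴ x
    rw [conjTranspose_conjTranspose] at h2
    rw [h1, h2]
    simp [Complex.normSq_conj]
  set r := ∑ y, Complex.normSq (V x y) with hr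
  have hrpos : 0 < r :=
    Finset.sum_pos' (fun y _ => Complex.normSq_nonneg _)
      ⟨y, Finset.mem_univ _, Complex.normSq_pos.mpr hy⟩
  refine ⟨((√r)⁻¹ : ℝ), ?_⟩
  refine mul_eq_one_comm.mp ?_
  rw [conjTranspose_smul, Matrix.smul_mul, Matrix.mul_smul, ← hs, smul_smul, hsx,
    Complex.star_def, Complex.conj_ofReal, ← Complex.ofReal_mul, ← mul_inv,
    Real.mul_self_sqrt hrpos.le, scalar_apply]
  ext i j
  by_cases hij : i = j
  · subst hij
    simp [hrpos.ne']
  · simp [hij]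

theorem exists_block_mul_ne_zero [Nonempty a] (hU : U ∈ unitaryGroup (a × b) ℂ) (hP : P ≠ 0) :
    ∃ χ φ, block U χ φ * P ≠ 0 := by
  by_contra! h
  obtain ⟨φ⟩ := ‹Nonempty a›
  have h1 := mem_unitaryGroup_iff_block.mp hU φ φ
  rw [if_pos rfl] at h1
  apply hP
  rw [← Matrix.one_mul P, ← h1, Matrix.sum_mul]
  refine Finset.sum_eq_zero fun χ _ => ?_
  rw [Matrix.mul_assoc, h, mul_zero]

/-- In a sector on which `Uᴴ (X ⊗ 1) U` acts trivially, `U` acts as a unitary of the first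
system. -/
theorem exists_unitary_of_scalar [Nonempty a] (hU : U ∈ unitaryGroup (a × b) ℂ)
    (hP : IsStarProjection P) (hP0 : P ≠ 0)
    (h : ∀ χ φ χ' φ', ∃ z : ℂ, (block U χ' φ')ᴴ * block U χ φ * P = z • P) :
    ∃ V : Matrix a a ℂ, Vᴴ * V = 1 ∧ ∀ χ φ χ' φ',
      ((block U χ' φ')ᴴ * block U χ φ * P).trace / P.rank = V χ φ * star (V χ' φ') := by
  choose z hz using h
  have hrank : (P.rank : ℂ) ≠ 0 := Nat.cast_ne_zero.mpr (rank_ne_zero_of_isStarProjection hP hP0)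
  have htr := trace_eq_rank_of_isStarProjection hP
  have hzt : ∀ χ φ χ' φ', ((block U χ' φ')ᴴ * block U χ φ * P).trace = z χ φ χ' φ' * P.rank := by
    intro χ φ χ' φ'
    rw [hz, trace_smul, htr, smul_eq_mul]
  have hPs : Pᴴ = P := hP.isSelfAdjoint
  have hPP : P * P = P := hP.isIdempotentElem.eq
  have hzstar : ∀ χ φ χ' φ', star (z χ φ χ' φ') = z χ' φ' χ φ := by
    intro χ φ χ' φ'
    have h1 : P * ((block U χ' φ')ᴴ * block U χ φ * P) = z χ φ χ' φ' • P := by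
      rw [hz, Matrix.mul_smul, hPP]
    have h2 : P * ((block U χ φ)ᴴ * block U χ' φ' * P) = z χ' φ' χ φ • P := by
      rw [hz, Matrix.mul_smul, hPP]
    have h3 : star (z χ φ χ' φ') • P = z χ' φ' χ φ • P := by
      rw [← h2]
      have := congrArg conjTranspose h1
      rw [conjTranspose_smul, hPs] at this
      rw [← this]
      simp only [conjTranspose_mul, conjTranspose_conjTranspose, hPs, Matrix.mul_assoc]
    exact smul_left_injective ℂ hP0 h3
  obtain ⟨χ₀, φ₀, hne⟩ := exists_block_mul_ne_zero hU hP0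
  obtain ⟨x, y, hxy⟩ : ∃ x y, (block U χ₀ φ₀ * P) x y ≠ 0 := by
    by_contra! h0
    exact hne (Matrix.ext h0)
  -- On the sector, `Uᴴ (|χ'⟩⟨χ| ⊗ 1) U` acts as `Z χ' χ ⊗ P`. Reading off one fixed source entry
  -- `(x, y)` of `U (1 ⊗ P)` gives an intertwiner between `Z` and the matrix units. The entry is
  -- chosen so that the intertwiner is nonzero.
  obtain ⟨M, hM⟩ : ∃ M : Matrix a a ℂ, ∀ χ φ, M χ φ = (block U χ φ * P) x y :=
    ⟨fun χ φ => (block U χ φ * P) x y, fun _ _ => rfl⟩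
  obtain ⟨Z, hZ⟩ : ∃ Z : a → a → Matrix a a ℂ, ∀ χ' χ φ' φ, Z χ' χ φ' φ = z χ φ χ' φ' :=
    ⟨fun χ' χ φ' φ => z χ φ χ' φ', fun _ _ _ _ => rfl⟩
  have hint : ∀ χ' χ, M * Z χ' χ = single χ' χ 1 * M := by
    intro χ' χ
    ext ξ φ
    have h1 : ∑ φ', z χ φ χ' φ' • (block U ξ φ' * P) =
        (if ξ = χ' then 1 else 0) * (block U χ φ * P) := by
      rw [← sum_block_mul_conjTranspose hU, Matrix.sum_mul]
      refine Finset.sum_congr rfl fun φ' _ => ?_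
      rw [← Matrix.mul_smul, ← hz]
      simp only [Matrix.mul_assoc]
    have h2 := congrFun (congrFun h1 x) y
    rw [Matrix.sum_apply] at h2
    simp only [Matrix.smul_apply, smul_eq_mul, ← hM] at h2
    rw [Matrix.mul_apply]
    simp only [hZ, mul_comm (M ξ _)]
    rw [h2]
    by_cases hξ : ξ = χ'
    · subst hξ
      simp [hM]
    · simp [hξ]
  have hMne : M ≠ 0 := by
    intro h0
    apply hxy
    rw [← hM, h0]
    rfl
  obtain ⟨c, hc⟩ := conjTranspose_mul_self_eq_one_of_intertwining hMne
    (fun χ' χ => by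
      ext φ' φ
      rw [conjTranspose_apply, hZ, hZ, hzstar]) hint
  refine ⟨c • M, hc, fun χ φ χ' φ' => ?_⟩
  rw [hzt, mul_div_cancel_right₀ _ hrank, ← hZ]
  have e : Z χ' χ = (c • M)ᴴ * single χ' χ 1 * (c • M) := by
    rw [Matrix.mul_assoc, Matrix.mul_smul, ← hint, ← Matrix.smul_mul, ← Matrix.mul_assoc, hc,
      Matrix.one_mul]
  rw [e, Matrix.mul_assoc, Matrix.mul_apply, Finset.sum_eq_single χ']
  · rw [single_mul_apply_same, conjTranspose_apply]
    ring
  · intro ξ _ hξ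
    rw [single_mul_apply_of_ne _ _ _ _ _ hξ, mul_zero]
  · simp

/-- A central sector of rank `d` is mapped onto another sector of rank `d`, giving a `d × d` array
of operators of the first system. -/
theorem exists_kraus_of_commute [Nonempty a] (hU : U ∈ unitaryGroup (a × b) ℂ)
    (hP : IsStarProjection P)
    (h : ∀ χ φ χ' φ', Commute ((block U χ' φ')ᴴ * block U χ φ) P) :
    ∃ M : Fin P.rank → Fin P.rank → Matrix a a ℂ, (∀ k, ∑ c, (M c k)ᴴ * M c k = 1) ∧
      ∀ χ φ χ' φ', ((block U χ' φ')ᴴ * block U χ φ * P).trace =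
        ∑ k, ∑ c, M c k χ φ * star (M c k χ' φ') := by
  obtain ⟨ξ⟩ := ‹Nonempty a›
  have hPs : Pᴴ = P := hP.isSelfAdjoint
  have hPP : P * P = P := hP.isIdempotentElem.eq
  -- `F χ` is the `χ`-th diagonal block of `U (1 ⊗ P) Uᴴ`. Inserting `∑ η, U_{ξη} U_{ξη}ᴴ = 1` and
  -- moving `P` past `U_{ξη}ᴴ U_{χφ}` shows that it does not depend on `χ`. The common value `R` is
  -- the projector onto the image sector.
  set F : a → Matrix b b ℂ := fun χ => ∑ φ, block U χ φ * P * (block U χ φ)ᴴ with hF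
  have hconst : ∀ χ, F χ = F ξ := by
    intro χ
    have h1 : F χ = ∑ η, ∑ φ, block U ξ η * P * (block U ξ η)ᴴ * block U χ φ * (block U χ φ)ᴴ := by
      have := sum_block_mul_conjTranspose hU ξ ξ
      rw [if_pos rfl] at this
      rw [← Matrix.one_mul (F χ), ← this, Matrix.sum_mul]
      refine Finset.sum_congr rfl fun η _ => ?_
      rw [hF, Matrix.mul_sum]
      refine Finset.sum_congr rfl fun φ _ => ?_
      have hc := (h χ φ ξ η).eq
      calc block U ξ η * (block U ξ η)ᴴ * (block U χ φ * P * (block U χ φ)ᴴ)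
          = block U ξ η * ((block U ξ η)ᴴ * block U χ φ * P) * (block U χ φ)ᴴ := by
            simp only [Matrix.mul_assoc]
        _ = _ := by
            rw [hc]
            simp only [Matrix.mul_assoc]
    rw [h1]
    refine Finset.sum_congr rfl fun η _ => ?_
    have := sum_block_mul_conjTranspose hU χ χ
    rw [if_pos rfl] at this
    simp only [Matrix.mul_assoc, ← Matrix.mul_sum, this, Matrix.mul_one]
  set R := F ξ with hR
  have hRK : ∀ χ φ, R * (block U χ φ * P) = block U χ φ * P := by
    intro χ φ
    have := sum_block_mul_conjTranspose hU χ χ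
    rw [if_pos rfl] at this
    rw [← hconst χ, hF]
    conv_rhs => rw [← Matrix.one_mul (block U χ φ * P), ← this]
    rw [Matrix.sum_mul, Matrix.sum_mul]
    refine Finset.sum_congr rfl fun η _ => ?_
    calc block U χ η * P * (block U χ η)ᴴ * (block U χ φ * P)
        = block U χ η * (P * ((block U χ η)ᴴ * block U χ φ)) * P := by
          simp only [Matrix.mul_assoc]
      _ = block U χ η * ((block U χ η)ᴴ * block U χ φ) * (P * P) := by
          rw [← (h χ φ χ η).eq]
          simp only [Matrix.mul_assoc]
      _ = _ := by
          rw [hPP]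
          simp only [Matrix.mul_assoc]
  have hRproj : IsStarProjection R := by
    refine ⟨?_, ?_⟩
    · change R * R = R
      have hRsum : R = ∑ φ, block U ξ φ * P * (block U ξ φ)ᴴ := rfl
      calc R * R = R * ∑ φ, block U ξ φ * P * (block U ξ φ)ᴴ := congrArg (R * ·) hRsum
        _ = ∑ φ, R * (block U ξ φ * P) * (block U ξ φ)ᴴ := by
            simp only [Matrix.mul_sum, Matrix.mul_assoc]
        _ = R := by simp only [hRK, ← hRsum]
    · change Rᴴ = R
      rw [hR, hF]
      simp only [conjTranspose_sum, conjTranspose_mul, conjTranspose_conjTranspose, hPs,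
        Matrix.mul_assoc]
  -- Both sides are computed from the trace of `U (1 ⊗ P) Uᴴ`, divided by the dimension of the first
  -- system. Equal traces give equal ranks, so `J` and `J'` can share the index type `Fin d`.
  have htrR : R.trace = P.trace := by
    have h1 : ∑ χ, (F χ).trace = Fintype.card a * R.trace := by
      simp [hconst]
    have h2 : ∑ χ, (F χ).trace = Fintype.card a * P.trace := by
      simp only [hF, trace_sum]
      rw [Finset.sum_comm]
      have : ∀ φ, ∑ χ, (block U χ φ * P * (block U χ φ)ᴴ).trace = P.trace := by
        intro φ
        have h3 := mem_unitaryGroup_iff_block.mp hU φ φ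
        rw [if_pos rfl] at h3
        conv_rhs => rw [← Matrix.one_mul P, ← h3, Matrix.sum_mul, trace_sum]
        refine Finset.sum_congr rfl fun χ _ => ?_
        rw [trace_mul_comm, Matrix.mul_assoc]
      simp [this]
    have hne : (Fintype.card a : ℂ) ≠ 0 :=
      Nat.cast_ne_zero.mpr (Fintype.card_pos_iff.mpr ⟨ξ⟩).ne'
    exact mul_left_cancel₀ hne (h1.symm.trans h2)
  have hrank : R.rank = P.rank := by
    rw [trace_eq_rank_of_isStarProjection hP, trace_eq_rank_of_isStarProjection hRproj] at htrR
    exact_mod_cast htrR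
  have hisoP := exists_isometry_of_isStarProjection hP
  have hisoR := exists_isometry_of_isStarProjection hRproj
  rw [hrank] at hisoR
  generalize P.rank = d at hisoP hisoR ⊢
  obtain ⟨J, hJ1, hJ2⟩ := hisoP
  obtain ⟨J', -, hJ'⟩ := hisoR
  have hPJ : P * J = J := by rw [← hJ2, Matrix.mul_assoc, hJ1, Matrix.mul_one]
  have hRKJ : ∀ χ φ, J' * (J'ᴴ * block U χ φ * J) = block U χ φ * J := by
    intro χ φ
    calc J' * (J'ᴴ * block U χ φ * J) = (J' * J'ᴴ) * (block U χ φ * (P * J)) := by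
          rw [hPJ]
          simp only [Matrix.mul_assoc]
      _ = R * (block U χ φ * P) * J := by
          rw [hJ']
          simp only [Matrix.mul_assoc]
      _ = _ := by rw [hRK, Matrix.mul_assoc, hPJ]
  -- `M c k` is the operator that `U` induces on the first system when the source goes from basis
  -- vector `k` of the sector to basis vector `c` of its image. The image exhausts the range, hence
  -- the isometry relation after summing over `c`.
  obtain ⟨M, hM⟩ : ∃ M : Fin d → Fin d → Matrix a a ℂ, ∀ c k χ φ,
      M c k χ φ = (J'ᴴ * block U χ φ * J) c k :=
    ⟨fun c k χ φ => (J'ᴴ * block U χ φ * J) c k, fun _ _ _ _ => rfl⟩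
  refine ⟨M, fun k => ?_, fun χ φ χ' φ' => ?_⟩
  · ext φ' φ
    rw [Matrix.sum_apply]
    simp only [Matrix.mul_apply (M := (M _ k)ᴴ), conjTranspose_apply, hM]
    rw [Finset.sum_comm]
    have e : ∀ χ, ∑ c, star ((J'ᴴ * block U χ φ' * J) c k) * (J'ᴴ * block U χ φ * J) c k =
        (Jᴴ * ((block U χ φ')ᴴ * block U χ φ) * J) k k := by
      intro χ
      have : (J'ᴴ * block U χ φ' * J)ᴴ * (J'ᴴ * block U χ φ * J) =
          Jᴴ * ((block U χ φ')ᴴ * block U χ φ) * J := by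
        have := hRKJ χ φ
        calc (J'ᴴ * block U χ φ' * J)ᴴ * (J'ᴴ * block U χ φ * J)
            = Jᴴ * (block U χ φ')ᴴ * (J' * (J'ᴴ * block U χ φ * J)) := by
              simp only [conjTranspose_mul, conjTranspose_conjTranspose, Matrix.mul_assoc]
          _ = _ := by
              rw [this]
              simp only [Matrix.mul_assoc]
      rw [← this, Matrix.mul_apply]
      rfl
    simp only [e]
    rw [← Matrix.sum_apply, ← Matrix.sum_mul, ← Matrix.mul_sum, mem_unitaryGroup_iff_block.mp hU]
    by_cases hφ : φ' = φ
    · subst hφ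
      simp [hJ1]
    · simp [hφ]
  · simp only [hM]
    have e : (J'ᴴ * block U χ φ * J) * (J'ᴴ * block U χ' φ' * J)ᴴ =
        J'ᴴ * (block U χ φ * P * (block U χ' φ')ᴴ * J') := by
      rw [← hJ2]
      simp only [conjTranspose_mul, conjTranspose_conjTranspose, Matrix.mul_assoc]
    calc ((block U χ' φ')ᴴ * block U χ φ * P).trace
        = (R * (block U χ φ * P) * (block U χ' φ')ᴴ).trace := by
          rw [hRK, trace_mul_comm _ (block U χ' φ')ᴴ, Matrix.mul_assoc]
      _ = ((J'ᴴ * block U χ φ * J) * (J'ᴴ * block U χ' φ' * J)ᴴ).trace := by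
          rw [e, trace_mul_comm J'ᴴ, ← hJ', Matrix.mul_assoc (block U χ φ * P * _),
            trace_mul_comm (block U χ φ * P * _), Matrix.mul_assoc (J' * J'ᴴ)]
      _ = _ := by
          rw [Finset.sum_comm, Matrix.trace]
          refine Finset.sum_congr rfl fun c _ => ?_
          rw [Matrix.diag_apply, Matrix.mul_apply]
          rfl

/-- The action in each sector is given by an `e × e` array of Kraus operators, `e²` being the
dimension that the sector contributes to the output. -/
theorem IsEssentialDecomposition.exists_kraus {c : Type*} [Fintype c] [DecidableEq c] [Nonempty a]
    {σ : Matrix (b × c) (b × c) ℂ} (hσ : σ.IsHermitian) {P : ι → Matrix b b ℂ} {t : ι → SectorType}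
    (hd : IsEssentialDecomposition σ P t) (hU : U ∈ unitaryGroup (a × b) ℂ)
    (h : ∀ χ φ χ' φ', (block U χ' φ')ᴴ * block U χ φ ∈ localCommutant σ) (i : ι) :
    ∃ e : ℕ, e ≠ 0 ∧ outputDim (t i) (P i).rank = e * e ∧
      ∃ M : Fin e → Fin e → Matrix a a ℂ, (∀ k, ∑ c, (M c k)ᴴ * M c k = 1) ∧
        ∀ χ φ χ' φ', ((block U χ' φ')ᴴ * block U χ φ * P i).trace / (P i).rank =
          (e : ℂ)⁻¹ * ∑ k, ∑ c, M c k χ φ * star (M c k χ' φ') := by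
  have hP := hd.isStarProjection i
  cases hi : t i with
  | I =>
    obtain ⟨V, hV, hV'⟩ := exists_unitary_of_scalar hU hP (hd.ne_zero i)
      fun χ φ χ' φ' => hd.exists_mul_eq_smul_of_typeI hσ hi (h χ φ χ' φ')
    refine ⟨1, one_ne_zero, rfl, fun _ _ => V, fun _ => by simpa using hV, fun χ φ χ' φ' => ?_⟩
    simpa using hV' χ φ χ' φ'
  | II =>
    obtain ⟨M, hM, hM'⟩ := exists_kraus_of_commute hU hP
      fun χ φ χ' φ' => hd.commute_of_mem hσ i (h χ φ χ' φ')
    refine ⟨(P i).rank, rank_ne_zero_of_isStarProjection hP (hd.ne_zero i), sq _, M, hM,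
      fun χ φ χ' φ' => ?_⟩
    rw [hM', div_eq_inv_mul]

end SectorForm

/-! ### The spectrum of the delocalized randomness-exhausting output -/

section Dreo

variable {b₀ b₁ ι₀ ι₁ : Type*} [Fintype b₀] [Fintype b₁] [Fintype ι₀] [Fintype ι₁]
  {σ : Matrix (b₀ × b₁) (b₀ × b₁) ℂ} {P₀ : ι₀ → Matrix b₀ b₀ ℂ} {t₀ : ι₀ → SectorType}
  {P₁ : ι₁ → Matrix b₁ b₁ ℂ} {t₁ : ι₁ → SectorType}

/-- The probability `Tr[(Pᵢ ⊗ Qⱼ) σ]` of a pair of sectors. -/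
noncomputable def sectorWeight (σ : Matrix (b₀ × b₁) (b₀ × b₁) ℂ) (P₀ : ι₀ → Matrix b₀ b₀ ℂ)
    (P₁ : ι₁ → Matrix b₁ b₁ ℂ) (i : ι₀) (j : ι₁) : ℝ :=
  ((P₀ i ⊗ₖ P₁ j) * σ).trace.re

theorem trace_kronecker_mul_nonneg (hσ : σ.PosSemidef) {P : Matrix b₀ b₀ ℂ} {Q : Matrix b₁ b₁ ℂ}
    (hP : IsStarProjection P) (hQ : IsStarProjection Q) : 0 ≤ ((P ⊗ₖ Q) * σ).trace := by
  have hPs : Pᴴ = P := hP.isSelfAdjoint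
  have hQs : Qᴴ = Q := hQ.isSelfAdjoint
  have h := (hσ.mul_mul_conjTranspose_same (P ⊗ₖ Q)).trace_nonneg
  rwa [conjTranspose_kronecker, hPs, hQs, trace_mul_comm, ← Matrix.mul_assoc, ← mul_kronecker_mul,
    hP.isIdempotentElem.eq, hQ.isIdempotentElem.eq] at h

variable [DecidableEq b₀] [DecidableEq b₁]

theorem sectorWeight_nonneg (hσ : IsState σ) (h₀ : IsEssentialDecomposition σ P₀ t₀)
    (h₁ : IsEssentialDecomposition (swapState σ) P₁ t₁) (i : ι₀) (j : ι₁) :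
    0 ≤ sectorWeight σ P₀ P₁ i j :=
  (Complex.nonneg_iff.mp (trace_kronecker_mul_nonneg hσ.1 (h₀.isStarProjection i)
    (h₁.isStarProjection j))).1

theorem ofReal_sectorWeight (hσ : IsState σ) (h₀ : IsEssentialDecomposition σ P₀ t₀)
    (h₁ : IsEssentialDecomposition (swapState σ) P₁ t₁) (i : ι₀) (j : ι₁) :
    (sectorWeight σ P₀ P₁ i j : ℂ) = ((P₀ i ⊗ₖ P₁ j) * σ).trace := by
  have h := Complex.nonneg_iff.mp (trace_kronecker_mul_nonneg hσ.1 (h₀.isStarProjection i)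
    (h₁.isStarProjection j))
  exact Complex.ext rfl h.2

theorem sum_sectorWeight (hσ : IsState σ) (h₀ : IsEssentialDecomposition σ P₀ t₀)
    (h₁ : IsEssentialDecomposition (swapState σ) P₁ t₁) :
    ∑ i, ∑ j, sectorWeight σ P₀ P₁ i j = 1 := by
  have e : (1 : Matrix (b₀ × b₁) (b₀ × b₁) ℂ) = ∑ i, ∑ j, P₀ i ⊗ₖ P₁ j := by
    rw [← one_kronecker_one, ← h₀.sum_eq_one, ← h₁.sum_eq_one]
    ext ⟨x, y⟩ ⟨x', y'⟩
    simp only [Matrix.sum_apply, kroneckerMap_apply, Finset.sum_mul_sum]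
  have h : (σ.trace : ℂ) = ∑ i, ∑ j, (sectorWeight σ P₀ P₁ i j : ℂ) := by
    simp only [ofReal_sectorWeight hσ h₀ h₁, ← trace_sum, ← Finset.sum_mul, ← e, Matrix.one_mul]
  rw [hσ.2] at h
  exact_mod_cast h.symm

end Dreo

section DreoSpectrum

variable {b₀ b₁ ι₀ ι₁ : Type*} [Fintype b₀] [Fintype b₁] [Fintype ι₀] [Fintype ι₁]
  [DecidableEq b₀] [DecidableEq b₁]

/-- The eigenvalue of the output in a pair of sectors. -/
noncomputable def dreoEigenvalue (σ : Matrix (b₀ × b₁) (b₀ × b₁) ℂ) (P₀ : ι₀ → Matrix b₀ b₀ ℂ)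
    (t₀ : ι₀ → SectorType) (P₁ : ι₁ → Matrix b₁ b₁ ℂ) (t₁ : ι₁ → SectorType) (i : ι₀) (j : ι₁) :
    ℝ :=
  sectorWeight σ P₀ P₁ i j /
    (outputDim (t₀ i) (P₀ i).rank * outputDim (t₁ j) (P₁ j).rank)

variable {σ : Matrix (b₀ × b₁) (b₀ × b₁) ℂ} {P₀ : ι₀ → Matrix b₀ b₀ ℂ} {t₀ : ι₀ → SectorType}
  {P₁ : ι₁ → Matrix b₁ b₁ ℂ} {t₁ : ι₁ → SectorType}

theorem IsEssentialDecomposition.outputDim_ne_zero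
    (h₀ : IsEssentialDecomposition σ P₀ t₀) (i : ι₀) : outputDim (t₀ i) (P₀ i).rank ≠ 0 := by
  cases hi : t₀ i with
  | I => exact one_ne_zero
  | II =>
    exact pow_ne_zero 2
      (rank_ne_zero_of_isStarProjection (h₀.isStarProjection i) (h₀.ne_zero i))

variable [DecidableEq ι₀] [DecidableEq ι₁]

/-- The DREO is diagonal by construction, so its entropy is that of an explicit family of weights.
-/
theorem delocalizedCatalyticEntropy_eq (hσ : IsState σ) (h₀ : IsEssentialDecomposition σ P₀ t₀)
    (h₁ : IsEssentialDecomposition (swapState σ) P₁ t₁) (α : ℝ) :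
    delocalizedCatalyticEntropy α σ P₀ t₀ P₁ t₁ =
      familyEntropy α (fun x : Σ ij : ι₀ × ι₁, Fin (outputDim (t₀ ij.1) (P₀ ij.1).rank) ×
        Fin (outputDim (t₁ ij.2) (P₁ ij.2).rank) =>
          dreoEigenvalue σ P₀ t₀ P₁ t₁ x.1.1 x.1.2) := by
  have e : dreo σ P₀ t₀ P₁ t₁ = diagonal (fun x : Σ ij : ι₀ × ι₁,
      Fin (outputDim (t₀ ij.1) (P₀ ij.1).rank) × Fin (outputDim (t₁ ij.2) (P₁ ij.2).rank) =>
        ((dreoEigenvalue σ P₀ t₀ P₁ t₁ x.1.1 x.1.2 : ℝ) : ℂ)) := by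
    have hb : ∀ ij : ι₀ × ι₁, ((P₀ ij.1 ⊗ₖ P₁ ij.2) * σ).trace •
        (maximallyMixed (outputDim (t₀ ij.1) (P₀ ij.1).rank) ⊗ₖ
          maximallyMixed (outputDim (t₁ ij.2) (P₁ ij.2).rank)) =
        diagonal fun _ => ((dreoEigenvalue σ P₀ t₀ P₁ t₁ ij.1 ij.2 : ℝ) : ℂ) := by
      intro ij
      rw [maximallyMixed, maximallyMixed, smul_kronecker, kronecker_smul, one_kronecker_one,
        smul_smul, smul_smul, ← ofReal_sectorWeight hσ h₀ h₁, smul_one_eq_diagonal,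
        dreoEigenvalue]
      congr 1
      ext x
      push_cast
      rw [div_eq_mul_inv, mul_inv]
      ring
    rw [dreo]
    simp only [hb]
    exact blockDiagonal'_diagonal _
  rw [delocalizedCatalyticEntropy, e, renyiEntropy_diagonal]

end DreoSpectrum

/-! ### The upper bound -/

section UpperBound

theorem sum_comm_innermost {S X : Type*} [Fintype S] [Fintype X] {Γ : S → Type*}
    [∀ s, Fintype (Γ s)] (G : ∀ s, Γ s → Γ s → X → ℂ) :
    ∑ s, ∑ k, ∑ c, ∑ x, G s k c x = ∑ x, ∑ s, ∑ k, ∑ c, G s k c x := by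
  symm
  rw [Finset.sum_comm]
  refine Finset.sum_congr rfl fun s _ => ?_
  rw [Finset.sum_comm]
  exact Finset.sum_congr rfl fun k _ => Finset.sum_comm

theorem mul_mul_conjTranspose_apply {a : Type*} [Fintype a] (M ρ : Matrix a a ℂ) (χ χ' : a) :
    (M * ρ * Mᴴ) χ χ' = ∑ x : a × a, ρ x.1 x.2 * (M χ x.1 * star (M χ' x.2)) := by
  rw [Matrix.mul_apply, Fintype.sum_prod_type, Finset.sum_comm]
  refine Finset.sum_congr rfl fun φ' _ => ?_
  rw [Matrix.mul_apply, Finset.sum_mul]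
  refine Finset.sum_congr rfl fun φ _ => ?_
  rw [conjTranspose_apply]
  ring

theorem posSemidef_catalyticMap {a₀ a₁ b₀ b₁ : Type*} [Fintype a₀] [Fintype a₁] [Fintype b₀]
    [Fintype b₁] {U₀ : Matrix (a₀ × b₀) (a₀ × b₀) ℂ} {U₁ : Matrix (a₁ × b₁) (a₁ × b₁) ℂ}
    {σ : Matrix (b₀ × b₁) (b₀ × b₁) ℂ} {ρ : Matrix (a₀ × a₁) (a₀ × a₁) ℂ}
    (hσ : σ.PosSemidef) (hρ : ρ.PosSemidef) :
    (catalyticMap U₀ U₁ σ ρ).PosSemidef := by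
  have hJ : (jointOutput U₀ U₁ σ ρ).PosSemidef :=
    (hρ.kronecker hσ).mul_mul_conjTranspose_same _
  have e : catalyticMap U₀ U₁ σ ρ =
      ∑ k, (jointOutput U₀ U₁ σ ρ).submatrix (fun χ => (χ, k)) (fun χ => (χ, k)) := by
    ext χ χ'
    rw [Matrix.sum_apply]
    rfl
  rw [e]
  exact posSemidef_sum _ fun k _ => hJ.submatrix _

variable {a₀ a₁ b₀ b₁ ι₀ ι₁ : Type*} [Fintype a₀] [Fintype a₁] [Fintype b₀] [Fintype b₁]
  [Fintype ι₀] [Fintype ι₁] [DecidableEq a₀] [DecidableEq a₁] [DecidableEq b₀] [DecidableEq b₁]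
  {σ : Matrix (b₀ × b₁) (b₀ × b₁) ℂ} {P₀ : ι₀ → Matrix b₀ b₀ ℂ} {t₀ : ι₀ → SectorType}
  {P₁ : ι₁ → Matrix b₁ b₁ ℂ} {t₁ : ι₁ → SectorType}
  {U₀ : Matrix (a₀ × b₀) (a₀ × b₀) ℂ} {U₁ : Matrix (a₁ × b₁) (a₁ × b₁) ℂ}
  {ρ : Matrix (a₀ × a₁) (a₀ × a₁) ℂ}

theorem trace_catalyticMap (hU₀ : U₀ ∈ unitaryGroup (a₀ × b₀) ℂ)
    (hU₁ : U₁ ∈ unitaryGroup (a₁ × b₁) ℂ) :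
    (catalyticMap U₀ U₁ σ ρ).trace = ρ.trace * σ.trace := by
  have h : (catalyticMap U₀ U₁ σ ρ).trace = (jointOutput U₀ U₁ σ ρ).trace := by
    rw [trace_eq_sum_block (jointOutput U₀ U₁ σ ρ)]
    rfl
  have hU : (pairUnitary U₀ U₁)ᴴ * pairUnitary U₀ U₁ = 1 :=
    mem_unitaryGroup_iff'.mp (pairUnitary_mem_unitaryGroup hU₀ hU₁)
  rw [h, jointOutput, Matrix.mul_assoc, trace_mul_comm, Matrix.mul_assoc, hU, Matrix.mul_one,
    trace_kronecker]

/-- The output of a compatible pair majorizes the product of the initial state and the delocalized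
randomness-exhausting output. -/
theorem sum_map_nonzeroSpectrum_catalyticMap_le [Nonempty a₀] [Nonempty a₁] (hσ : IsState σ)
    (h₀ : IsEssentialDecomposition σ P₀ t₀) (h₁ : IsEssentialDecomposition (swapState σ) P₁ t₁)
    (hU₀ : U₀ ∈ unitaryGroup (a₀ × b₀) ℂ) (hU₁ : U₁ ∈ unitaryGroup (a₁ × b₁) ℂ)
    (hc : IsCompatible U₀ U₁ σ) (hρ : ρ.PosSemidef) {f : ℝ → ℝ}
    (hf : ConcaveOn ℝ (Set.Ici 0) f) (hf0 : f 0 = 0) :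
    ((nonzeroSpectrum (catalyticMap U₀ U₁ σ ρ)).map f).sum ≤
      ∑ x : Σ ij : ι₀ × ι₁, Fin (outputDim (t₀ ij.1) (P₀ ij.1).rank) ×
        Fin (outputDim (t₁ ij.2) (P₁ ij.2).rank),
        ∑ l, f (dreoEigenvalue σ P₀ t₀ P₁ t₁ x.1.1 x.1.2 * hρ.isHermitian.eigenvalues l) := by
  have hσH := hσ.1.isHermitian
  have hm₀ := mem_localCommutant_of_isCompatible_left hU₀ hU₁ hσH hc
  have hm₁ := mem_localCommutant_of_isCompatible_right hU₀ hU₁ hσH hc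
  choose e₀ he₀ hD₀ M₀ hM₀ hK₀ using h₀.exists_kraus hσH hU₀ hm₀
  choose e₁ he₁ hD₁ M₁ hM₁ hK₁ using h₁.exists_kraus (isHermitian_swapState hσH) hU₁ hm₁
  -- The factors `1 / e` are the uniform averages over the input index `k` on each side.
  let w : ι₀ × ι₁ → ℝ := fun s => sectorWeight σ P₀ P₁ s.1 s.2 / (e₀ s.1 * e₁ s.2)
  let M : ∀ s : ι₀ × ι₁, Fin (e₀ s.1) × Fin (e₁ s.2) → Fin (e₀ s.1) × Fin (e₁ s.2) →
      Matrix (a₀ × a₁) (a₀ × a₁) ℂ := fun s c k => M₀ s.1 c.1 k.1 ⊗ₖ M₁ s.2 c.2 k.2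
  have hw : ∀ s, 0 ≤ w s := fun s =>
    div_nonneg (sectorWeight_nonneg hσ h₀ h₁ _ _) (by positivity)
  have hM : ∀ s k, ∑ c, (M s c k)ᴴ * M s c k = 1 := by
    intro s k
    simp only [M, conjTranspose_kronecker, ← mul_kronecker_mul, Fintype.sum_prod_type]
    rw [← one_kronecker_one, ← hM₀ s.1 k.1, ← hM₁ s.2 k.2]
    ext ⟨x, y⟩ ⟨x', y'⟩
    simp only [Matrix.sum_apply, kroneckerMap_apply, Finset.sum_mul_sum]
  have hN : catalyticMap U₀ U₁ σ ρ =
      ∑ s, ∑ k, ∑ c, (w s : ℂ) • (M s c k * ρ * (M s c k)ᴴ) := by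
    ext χ χ'
    rw [catalyticMap_apply]
    simp only [Matrix.sum_apply, Matrix.smul_apply, mul_mul_conjTranspose_apply, Finset.smul_sum]
    rw [sum_comm_innermost]
    refine Eq.trans ?_ (Fintype.sum_prod_type _).symm
    refine Finset.sum_congr rfl fun φ _ => Finset.sum_congr rfl fun φ' _ => ?_
    rw [trace_kronecker_mul_eq_sum hσH h₀ h₁ (hm₀ _ _ _ _) (hm₁ _ _ _ _), Fintype.sum_prod_type,
      Finset.mul_sum]
    refine Finset.sum_congr rfl fun i _ => ?_
    rw [Finset.mul_sum]
    refine Finset.sum_congr rfl fun j _ => ?_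
    rw [hK₀, hK₁, ← ofReal_sectorWeight hσ h₀ h₁]
    have hprod : (∑ k, ∑ c, M₀ i c k χ.1 φ.1 * star (M₀ i c k χ'.1 φ'.1)) *
        (∑ k, ∑ c, M₁ j c k χ.2 φ.2 * star (M₁ j c k χ'.2 φ'.2)) =
        ∑ k : Fin (e₀ i) × Fin (e₁ j), ∑ c : Fin (e₀ i) × Fin (e₁ j),
          M (i, j) c k χ φ * star (M (i, j) c k χ' φ') := by
      rw [Finset.sum_mul_sum, Fintype.sum_prod_type]
      refine Finset.sum_congr rfl fun k _ => Finset.sum_congr rfl fun k' _ => ?_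
      rw [Finset.sum_mul_sum, Fintype.sum_prod_type]
      refine Finset.sum_congr rfl fun c _ => Finset.sum_congr rfl fun c' _ => ?_
      simp only [M, kroneckerMap_apply, star_mul']
      ring
    simp only [smul_eq_mul, ← Finset.mul_sum]
    rw [← hprod]
    simp only [w]
    push_cast
    rw [div_eq_mul_inv, mul_inv]
    ring
  refine (sum_map_nonzeroSpectrum_kraus_le hw hM hρ hN hf hf0).trans_eq ?_
  rw [Fintype.sum_sigma]
  refine Finset.sum_congr rfl fun s _ => ?_
  -- The Jensen step over the output index contributes a second factor `1 / (e₀ e₁)`. Since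
  -- `outputDim` equals `e * e`, the result is an eigenvalue of the DREO, and the pairs `(k, c)`
  -- give its multiplicity.
  have hq : w s / Fintype.card (Fin (e₀ s.1) × Fin (e₁ s.2)) =
      dreoEigenvalue σ P₀ t₀ P₁ t₁ s.1 s.2 := by
    simp only [w, dreoEigenvalue, hD₀, hD₁, Fintype.card_prod, Fintype.card_fin, div_div]
    push_cast
    congr 1
    ring
  rw [hq]
  simp only [Finset.sum_const, Finset.card_univ, Fintype.card_prod, Fintype.card_fin, hD₀, hD₁,
    smul_smul]
  congr 1
  ring

theorem renyiEntropy_catalyticMap_le [DecidableEq ι₀] [DecidableEq ι₁] (hσ : IsState σ)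
    (h₀ : IsEssentialDecomposition σ P₀ t₀) (h₁ : IsEssentialDecomposition (swapState σ) P₁ t₁)
    (hU₀ : U₀ ∈ unitaryGroup (a₀ × b₀) ℂ) (hU₁ : U₁ ∈ unitaryGroup (a₁ × b₁) ℂ)
    (hc : IsCompatible U₀ U₁ σ) (hρ : IsState ρ) {α : ℝ} (hα : 0 ≤ α) :
    renyiEntropy α (catalyticMap U₀ U₁ σ ρ) ≤
      delocalizedCatalyticEntropy α σ P₀ t₀ P₁ t₁ + renyiEntropy α ρ := by
  -- A state has trace one, so the system cannot be empty.
  have hne : Nonempty (a₀ × a₁) := by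
    by_contra hempty
    rw [not_nonempty_iff] at hempty
    have := hρ.2
    simp [Matrix.trace] at this
  obtain ⟨x₀, x₁⟩ := hne
  have hne₀ : Nonempty a₀ := ⟨x₀⟩
  have hne₁ : Nonempty a₁ := ⟨x₁⟩
  have hN : (catalyticMap U₀ U₁ σ ρ).PosSemidef := posSemidef_catalyticMap hσ.1 hρ.1
  have hsum : ∀ {n : Type _} [Fintype n] [DecidableEq n] {M : Matrix n n ℂ} (hM : M.PosSemidef),
      M.trace = 1 → ∑ x, hM.isHermitian.eigenvalues x = 1 := by
    intro n _ _ M hM h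
    rw [hM.isHermitian.trace_eq_sum_eigenvalues, ← RCLike.ofReal_sum] at h
    exact Complex.ofReal_injective h
  rw [delocalizedCatalyticEntropy_eq hσ h₀ h₁, renyiEntropy_eq_familyEntropy hN.isHermitian,
    renyiEntropy_eq_familyEntropy hρ.1.isHermitian]
  refine familyEntropy_le_add hN.eigenvalues_nonneg
    (hsum hN (by rw [trace_catalyticMap hU₀ hU₁, hρ.2, hσ.2, one_mul]))
    (fun x => div_nonneg (sectorWeight_nonneg hσ h₀ h₁ _ _) (by positivity)) ?_
    hρ.1.eigenvalues_nonneg (hsum hρ.1 hρ.2) (fun f hf hf0 => ?_) hα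
  · rw [Fintype.sum_sigma, ← sum_sectorWeight hσ h₀ h₁, Fintype.sum_prod_type]
    refine Finset.sum_congr rfl fun i _ => Finset.sum_congr rfl fun j _ => ?_
    have d₀ : (outputDim (t₀ i) (P₀ i).rank : ℝ) ≠ 0 :=
      Nat.cast_ne_zero.mpr (h₀.outputDim_ne_zero i)
    have d₁ : (outputDim (t₁ j) (P₁ j).rank : ℝ) ≠ 0 :=
      Nat.cast_ne_zero.mpr (h₁.outputDim_ne_zero j)
    simp only [Finset.sum_const, Finset.card_univ, Fintype.card_prod, Fintype.card_fin,
      nsmul_eq_mul]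
    push_cast
    field_simp
  · rw [← sum_map_nonzeroSpectrum hN.isHermitian hf0]
    exact sum_map_nonzeroSpectrum_catalyticMap_le hσ h₀ h₁ hU₀ hU₁ hc hρ.1 hf hf0

end UpperBound

/-! ### Orthogonal unitaries -/

section Weyl

/-- A family of `d²` mutually orthogonal unitaries in dimension `d`. -/
theorem exists_orthogonal_unitaries {d : ℕ} (hd : d ≠ 0) :
    ∃ w : ℕ → Matrix (Fin d) (Fin d) ℂ, (∀ g, (w g)ᴴ * w g = 1) ∧
      ∀ g g', g < d ^ 2 → g' < d ^ 2 →
        ((w g')ᴴ * w g).trace = if g = g' then (d : ℂ) else 0 := by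
  have : NeZero d := ⟨hd⟩
  set ζ : ℂ := Complex.exp (2 * Real.pi * Complex.I / d) with hζ
  have hprim : IsPrimitiveRoot ζ d := Complex.isPrimitiveRoot_exp d hd
  have hnorm : star ζ * ζ = 1 := by
    have h1 : ‖ζ‖ = 1 := hprim.norm'_eq_one hd
    rw [Complex.star_def, ← Complex.normSq_eq_conj_mul_self, Complex.normSq_eq_norm_sq, h1]
    norm_num
  -- Clock-and-shift unitaries: the label `g` encodes a shift by `g % d` and a phase frequency `g /
  -- d`, so `g < d ^ 2` runs through all `d²` pairs.
  obtain ⟨w, hw⟩ : ∃ w : ℕ → Matrix (Fin d) (Fin d) ℂ, ∀ g r s,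
      w g r s = if r = s + Fin.ofNat d g then ζ ^ (g / d * s.val) else 0 :=
    ⟨fun g r s => if r = s + Fin.ofNat d g then ζ ^ (g / d * s.val) else 0, fun _ _ _ => rfl⟩
  have hpow : ∀ k, star (ζ ^ k) * ζ ^ k = 1 := by
    intro k
    rw [star_pow, ← mul_pow, hnorm, one_pow]
  have hmul : ∀ g g' s s', ((w g')ᴴ * w g) s s' =
      if s + Fin.ofNat d g' = s' + Fin.ofNat d g then
        star (ζ ^ (g' / d * s.val)) * ζ ^ (g / d * s'.val) else 0 := by
    intro g g' s s'
    rw [Matrix.mul_apply, Finset.sum_eq_single (s + Fin.ofNat d g')]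
    · rw [conjTranspose_apply, hw, hw, if_pos rfl, mul_ite, mul_zero]
    · intro r _ hr
      rw [conjTranspose_apply, hw, if_neg hr, star_zero, zero_mul]
    · simp
  refine ⟨w, fun g => ?_, fun g g' hg hg' => ?_⟩
  · ext s s'
    rw [hmul, Matrix.one_apply]
    by_cases h : s = s'
    · subst h
      simp only [if_true]
      exact hpow _
    · rw [if_neg (by simpa using h), if_neg h]
  · rw [Matrix.trace]
    simp only [Matrix.diag_apply, hmul, add_right_inj]
    rw [sq] at hg hg'
    by_cases hx : Fin.ofNat d g' = Fin.ofNat d g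
    · simp only [hx, if_true]
      have hmod : g' % d = g % d := by simpa using congrArg Fin.val hx
      set η : ℂ := star (ζ ^ (g' / d)) * ζ ^ (g / d) with hη
      have hterm : ∀ s : Fin d, star (ζ ^ (g' / d * s.val)) * ζ ^ (g / d * s.val) = η ^ s.val := by
        intro s
        rw [hη, mul_pow, pow_mul, pow_mul, star_pow]
      simp only [hterm]
      rw [Fin.sum_univ_eq_sum_range (fun k => η ^ k)]
      by_cases hz : g / d = g' / d
      · have hgg : g = g' := by
          rw [← Nat.div_add_mod g d, ← Nat.div_add_mod g' d, hz, hmod]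
        have h1 : η = 1 := by rw [hη, hz, hpow]
        simp [h1, hgg]
      · have hne : g ≠ g' := fun h => hz (by rw [h])
        rw [if_neg hne]
        -- Both frequencies are below `d`, where powers of a primitive root are distinct. The trace
        -- is therefore a geometric sum over a nontrivial `d`-th root of unity, which vanishes.
        have h1 : η ≠ 1 := by
          intro h1
          apply hz
          refine hprim.pow_inj (Nat.div_lt_of_lt_mul hg) (Nat.div_lt_of_lt_mul hg') ?_
          calc ζ ^ (g / d) = (star (ζ ^ (g' / d)) * ζ ^ (g' / d)) * ζ ^ (g / d) := by
                rw [hpow, one_mul]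
            _ = η * ζ ^ (g' / d) := by
                rw [hη]
                ring
            _ = ζ ^ (g' / d) := by rw [h1, one_mul]
        have hd1 : η ^ d = 1 := by
          rw [hη, mul_pow, ← star_pow, ← pow_mul, ← pow_mul, mul_comm (g' / d), mul_comm (g / d),
            pow_mul, pow_mul, hprim.pow_eq_one]
          simp
        have := mul_neg_geom_sum η d
        rw [hd1, sub_self] at this
        exact (mul_eq_zero.mp this).resolve_left (sub_ne_zero.mpr (Ne.symm h1))
    · have hne : g ≠ g' := fun h => hx (by rw [h])
      rw [if_neg hne]
      exact Finset.sum_eq_zero fun s _ => if_neg hx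

theorem exists_unitary_col {n : Type*} [Fintype n] [DecidableEq n] (φ₀ : n) {v : n → ℂ}
    (hv : ∑ χ, star (v χ) * v χ = 1) :
    ∃ V : Matrix n n ℂ, Vᴴ * V = 1 ∧ ∀ χ, V χ φ₀ = v χ := by
  have horth : Orthonormal ℂ
      (({φ₀} : Set n).domRestrict fun _ : n => (WithLp.toLp 2 v : EuclideanSpace ℂ n)) := by
    rw [orthonormal_iff_ite]
    rintro ⟨i, hi⟩ ⟨j, hj⟩
    obtain rfl : i = φ₀ := hi
    obtain rfl : j = i := hj
    simp only [Set.domRestrict_apply, if_true]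
    rw [← hv, EuclideanSpace.inner_eq_star_dotProduct]
    simp [dotProduct, mul_comm]
  obtain ⟨B, hB⟩ := horth.exists_orthonormalBasis_extension_of_card_eq (by simp)
  refine ⟨Matrix.of fun χ φ => B φ χ, ?_, fun χ => ?_⟩
  · ext φ φ'
    have h := orthonormal_iff_ite.mp B.orthonormal φ φ'
    rw [EuclideanSpace.inner_eq_star_dotProduct] at h
    rw [Matrix.one_apply, ← h, Matrix.mul_apply]
    simp [dotProduct, mul_comm]
  · rw [Matrix.of_apply, hB φ₀ rfl]

end Weyl

/-! ### An optimal local protocol -/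

section Protocol

variable {b c ι : Type*} [Fintype b] [Fintype c] [Fintype ι] [DecidableEq b] [DecidableEq c]
  {σ : Matrix (b × c) (b × c) ℂ} {P : ι → Matrix b b ℂ} {t : ι → SectorType}

/-- A type I sector needs one operator, its projector. In a type II sector every operator is in the
commutant, so the clock-and-shift family is transported there by an isometry. Labels range over `ℕ`
because the protocol also evaluates `w i` at labels belonging to other sectors; there only unitarity
on the sector is needed, not orthogonality. -/
theorem IsEssentialDecomposition.exists_sector_unitaries (h : IsEssentialDecomposition σ P t)
    (i : ι) :
    ∃ w : ℕ → Matrix b b ℂ, (∀ g, (w g)ᴴ * w g = P i ∧ w g * (w g)ᴴ = P i ∧ P i * w g = w g ∧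
      w g * P i = w g ∧ w g ∈ localCommutant σ) ∧
      ∀ g g', g < outputDim (t i) (P i).rank → g' < outputDim (t i) (P i).rank →
        ((w g')ᴴ * w g).trace = if g = g' then ((P i).rank : ℂ) else 0 := by
  have hP := h.isStarProjection i
  have hPP := h.mul_self i
  have hPs := h.conjTranspose_eq i
  cases hi : t i with
  | I =>
    refine ⟨fun _ => P i, fun _ => ⟨by rw [hPs, hPP], by rw [hPs, hPP], hPP, hPP,
      h.mem_localCommutant i⟩, fun g g' hg hg' => ?_⟩
    obtain rfl : g = 0 := Nat.lt_one_iff.mp hg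
    obtain rfl : g' = 0 := Nat.lt_one_iff.mp hg'
    rw [if_pos rfl, hPs, hPP, trace_eq_rank_of_isStarProjection hP]
  | II =>
    have hiso := exists_isometry_of_isStarProjection hP
    have hd := rank_ne_zero_of_isStarProjection hP (h.ne_zero i)
    change ∃ w : ℕ → Matrix b b ℂ, _ ∧ ∀ g g', g < (P i).rank ^ 2 → g' < (P i).rank ^ 2 → _
    generalize (P i).rank = d at hiso hd ⊢
    obtain ⟨J, hJ1, hJ2⟩ := hiso
    obtain ⟨w, hw, htr⟩ := exists_orthogonal_unitaries hd
    have hw' : ∀ g, w g * (w g)ᴴ = 1 := fun g => mul_eq_one_comm.mp (hw g)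
    have hmul : ∀ A B : Matrix (Fin d) (Fin d) ℂ,
        (J * A * Jᴴ) * (J * B * Jᴴ) = J * (A * B) * Jᴴ := by
      intro A B
      calc (J * A * Jᴴ) * (J * B * Jᴴ) = J * A * (Jᴴ * J) * B * Jᴴ := by
            simp only [Matrix.mul_assoc]
        _ = _ := by
            rw [hJ1, Matrix.mul_one]
            simp only [Matrix.mul_assoc]
    have hstar : ∀ A : Matrix (Fin d) (Fin d) ℂ, (J * A * Jᴴ)ᴴ = J * Aᴴ * Jᴴ := by
      intro A
      simp only [conjTranspose_mul, conjTranspose_conjTranspose, Matrix.mul_assoc]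
    have hone : J * (1 : Matrix (Fin d) (Fin d) ℂ) * Jᴴ = P i := by rw [Matrix.mul_one, hJ2]
    have e1 : ∀ g, P i * (J * w g * Jᴴ) = J * w g * Jᴴ := fun g => by
      rw [← hone, hmul, Matrix.one_mul]
    have e2 : ∀ g, (J * w g * Jᴴ) * P i = J * w g * Jᴴ := fun g => by
      rw [← hone, hmul, Matrix.mul_one]
    refine ⟨fun g => J * w g * Jᴴ, fun g => ⟨?_, ?_, e1 g, e2 g,
      h.mem_localCommutant_of_typeII hi (e1 g) (e2 g)⟩, fun g g' hg hg' => ?_⟩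
    · rw [hstar, hmul, hw, hone]
    · rw [hstar, hmul, hw', hone]
    · rw [hstar, hmul, trace_mul_comm, ← Matrix.mul_assoc, hJ1, Matrix.one_mul]
      exact htr g g' hg hg'

theorem sum_smul_mul_sum_smul_of_orthogonal {x y : ι → ℂ} {A B : ι → Matrix b b ℂ}
    (h : ∀ i j, i ≠ j → A i * B j = 0) :
    (∑ i, x i • A i) * (∑ j, y j • B j) = ∑ i, (x i * y i) • (A i * B i) := by
  rw [Matrix.sum_mul]
  refine Finset.sum_congr rfl fun i _ => ?_
  rw [Matrix.mul_sum, Finset.sum_eq_single i]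
  · rw [Matrix.smul_mul, Matrix.mul_smul, smul_smul]
  · intro j _ hj
    rw [Matrix.smul_mul, Matrix.mul_smul, h i j (Ne.symm hj), smul_zero, smul_zero]
  · simp

/-- A local unitary, with blocks in the commutant of the state, that maximally randomizes every
sector and records the sector. -/
theorem IsEssentialDecomposition.exists_protocol [Nonempty ι] [DecidableEq ι]
    (h : IsEssentialDecomposition σ P t) :
    ∃ (n : ℕ) (e : Fin n ≃ Σ i, Fin (outputDim (t i) (P i).rank))
      (U : Matrix (Fin n × b) (Fin n × b) ℂ) (φ₀ : Fin n),
      U ∈ unitaryGroup (Fin n × b) ℂ ∧ (∀ χ φ, block U χ φ ∈ localCommutant σ) ∧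
      (∀ φ φ', ∑ χ, block U χ φ * (block U χ φ')ᴴ = if φ = φ' then 1 else 0) ∧
      ∀ χ χ' i, ((block U χ' φ₀)ᴴ * block U χ φ₀ * P i).trace / (P i).rank =
        if χ = χ' ∧ (e χ).1 = i then (outputDim (t i) (P i).rank : ℂ)⁻¹ else 0 := by
  choose w hw htr using h.exists_sector_unitaries
  set D : ι → ℕ := fun i => outputDim (t i) (P i).rank with hD
  have hD0 : ∀ i, D i ≠ 0 := h.outputDim_ne_zero
  let e : Fin (Fintype.card (Σ i, Fin (D i))) ≃ Σ i, Fin (D i) := (Fintype.equivFin _).symm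
  obtain ⟨i₀⟩ := ‹Nonempty ι›
  let φ₀ : Fin (Fintype.card (Σ i, Fin (D i))) := e.symm ⟨i₀, ⟨0, Nat.pos_of_ne_zero (hD0 i₀)⟩⟩
  -- Conditioned on sector `i` of the source, the register is rotated from `φ₀` to the uniform
  -- superposition of the `D i` labels of that sector.
  have hV : ∀ i, ∃ V : Matrix (Fin (Fintype.card (Σ i, Fin (D i)))) _ ℂ, Vᴴ * V = 1 ∧
      ∀ χ, V χ φ₀ = if (e χ).1 = i then (((√(D i))⁻¹ : ℝ) : ℂ) else 0 := by
    intro i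
    refine exists_unitary_col φ₀ ?_
    rw [e.sum_comp (fun s => star (if s.1 = i then (((√(D i))⁻¹ : ℝ) : ℂ) else 0) *
      (if s.1 = i then (((√(D i))⁻¹ : ℝ) : ℂ) else 0)), Fintype.sum_sigma,
      Finset.sum_eq_single i]
    · have : (0 : ℝ) < D i := Nat.cast_pos.mpr (Nat.pos_of_ne_zero (hD0 i))
      simp only [if_true, Finset.sum_const, Finset.card_univ, Fintype.card_fin, Complex.star_def,
        Complex.conj_ofReal, ← Complex.ofReal_mul, ← mul_inv, Real.mul_self_sqrt this.le,
        nsmul_eq_mul]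
      push_cast
      exact mul_inv_cancel₀ (by exact_mod_cast hD0 i)
    · intro j _ hj
      simp [hj]
    · simp
  choose V hV1 hV2 using hV
  -- First `V i` acts on the register, controlled by the sector. Then the source unitary with the
  -- number stored in the register is applied, controlled by the register.
  obtain ⟨U, hU⟩ : ∃ U : Matrix (Fin (Fintype.card (Σ i, Fin (D i))) × b) _ ℂ,
      ∀ χ φ, block U χ φ = ∑ i, V i χ φ • w i (e χ).2 :=
    ⟨fun x y => (∑ i, V i x.1 y.1 • w i (e x.1).2) x.2 y.2, fun χ φ => rfl⟩
  have hstar : ∀ χ φ, (block U χ φ)ᴴ = ∑ i, star (V i χ φ) • (w i (e χ).2)ᴴ := by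
    intro χ φ
    rw [hU, conjTranspose_sum]
    simp only [conjTranspose_smul]
  have ho1 : ∀ g g' i j, i ≠ j → (w i g)ᴴ * w j g' = 0 := by
    intro g g' i j hij
    rw [← (hw i g).2.2.1, ← (hw j g').2.2.1, conjTranspose_mul, h.conjTranspose_eq,
      Matrix.mul_assoc, ← Matrix.mul_assoc (P i), h.orthogonal i j hij, Matrix.zero_mul,
      Matrix.mul_zero]
  have ho2 : ∀ g g' i j, i ≠ j → w i g * (w j g')ᴴ = 0 := by
    intro g g' i j hij
    rw [← (hw i g).2.2.2.1, ← (hw j g').2.2.2.1, conjTranspose_mul, h.conjTranspose_eq,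
      Matrix.mul_assoc, ← Matrix.mul_assoc (P i), h.orthogonal i j hij, Matrix.zero_mul,
      Matrix.mul_zero]
  have hVsum : ∀ i φ φ', ∑ χ, star (V i χ φ) * V i χ φ' = if φ = φ' then 1 else 0 := by
    intro i φ φ'
    have := congrFun (congrFun (hV1 i) φ) φ'
    rw [Matrix.mul_apply, Matrix.one_apply] at this
    exact this
  refine ⟨_, e, U, φ₀, ?_, fun χ φ => ?_, fun φ φ' => ?_, fun χ χ' i => ?_⟩
  · rw [mem_unitaryGroup_iff_block]
    intro φ φ'
    have : ∀ χ, (block U χ φ)ᴴ * block U χ φ' = ∑ i, (star (V i χ φ) * V i χ φ') • P i := by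
      intro χ
      rw [hstar, hU, sum_smul_mul_sum_smul_of_orthogonal (ho1 _ _)]
      simp only [(hw _ _).1]
    simp only [this]
    rw [Finset.sum_comm]
    simp only [← Finset.sum_smul, hVsum, ← Finset.smul_sum, h.sum_eq_one]
    split_ifs <;> simp
  · rw [hU]
    exact sum_mem fun i _ => Subalgebra.smul_mem _ (hw i _).2.2.2.2 _
  -- Reversing the order of the factors within each product gives the same sum, as `w wᴴ` and `wᴴ w`
  -- are both `P i`. This second relation is what compatibility needs, in addition to unitarity.
  · have : ∀ χ, block U χ φ * (block U χ φ')ᴴ = ∑ i, (V i χ φ * star (V i χ φ')) • P i := by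
      intro χ
      rw [hstar, hU, sum_smul_mul_sum_smul_of_orthogonal (ho2 _ _)]
      simp only [(hw _ _).2.1]
    simp only [this]
    rw [Finset.sum_comm]
    simp only [← Finset.sum_smul, mul_comm (V _ _ φ), hVsum, ← Finset.smul_sum, h.sum_eq_one,
      eq_comm (a := φ')]
    split_ifs <;> simp
  · have h1 : (block U χ' φ₀)ᴴ * block U χ φ₀ * P i =
        (star (V i χ' φ₀) * V i χ φ₀) • ((w i (e χ').2)ᴴ * w i (e χ).2) := by
      rw [hstar, hU, sum_smul_mul_sum_smul_of_orthogonal (ho1 _ _), Matrix.sum_mul,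
        Finset.sum_eq_single i]
      · rw [Matrix.smul_mul, Matrix.mul_assoc, (hw i _).2.2.2.1]
      · intro j _ hj
        rw [Matrix.smul_mul, Matrix.mul_assoc, ← (hw j (e χ).2).2.2.2.1, Matrix.mul_assoc (w j _),
          h.orthogonal j i hj, Matrix.mul_zero, Matrix.mul_zero, smul_zero]
      · simp
    have hrank : ((P i).rank : ℂ) ≠ 0 := Nat.cast_ne_zero.mpr
      (rank_ne_zero_of_isStarProjection (h.isStarProjection i) (h.ne_zero i))
    rw [h1, trace_smul, hV2, hV2, smul_eq_mul]
    by_cases hi : (e χ).1 = i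
    · by_cases hi' : (e χ').1 = i
      · rw [if_pos hi, if_pos hi', htr i _ _ (hi ▸ (e χ).2.2) (hi' ▸ (e χ').2.2)]
        -- Within one sector, equal labels mean equal register values. The orthogonality of the `w
        -- i` thus removes every coherence of the register.
        have hiff : ((e χ).2 : ℕ) = (e χ').2 ↔ χ = χ' := by
          constructor
          · intro hg
            apply e.injective
            refine Sigma.ext (hi.trans hi'.symm) ?_
            exact (Fin.heq_ext_iff (congrArg D (hi.trans hi'.symm))).mpr hg
          · rintro rfl
            rfl
        have hpos : (0 : ℝ) ≤ D i := Nat.cast_nonneg _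
        rw [Complex.star_def, Complex.conj_ofReal, ← Complex.ofReal_mul, ← mul_inv,
          Real.mul_self_sqrt hpos]
        by_cases hχ : χ = χ'
        · rw [if_pos (hiff.mpr hχ), if_pos ⟨hχ, hi⟩, mul_div_cancel_right₀ _ hrank]
          push_cast
          rfl
        · rw [if_neg (fun hg => hχ (hiff.mp hg)), if_neg (fun hg => hχ hg.1)]
          simp
      · rw [if_neg hi', if_neg (c := χ = χ' ∧ (e χ).1 = i) (fun hg => hi' (by rw [← hg.1, hi]))]
        simp
    · rw [if_neg hi, if_neg (c := χ = χ' ∧ (e χ).1 = i) (fun hg => hi hg.2)]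
      simp

end Protocol

/-! ### Attainability -/

section Attainability

/-- Tracing out the systems gives `∑ ρ_{φφ'} K_{χφ} σ K_{χφ'}ᴴ`. Blocks in the commutants let `σ` be
pulled out in front, and `∑ χ, K_{χφ} K_{χφ'}ᴴ = δ` leaves `Tr ρ` times `σ`. -/
theorem isCompatible_of_block_mem {a₀ a₁ b₀ b₁ : Type*} [Fintype a₀] [Fintype a₁] [Fintype b₀]
    [Fintype b₁] [DecidableEq a₀] [DecidableEq a₁] [DecidableEq b₀] [DecidableEq b₁]
    {σ : Matrix (b₀ × b₁) (b₀ × b₁) ℂ}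
    {U₀ : Matrix (a₀ × b₀) (a₀ × b₀) ℂ} {U₁ : Matrix (a₁ × b₁) (a₁ × b₁) ℂ}
    (hm₀ : ∀ χ φ, block U₀ χ φ ∈ localCommutant σ)
    (hm₁ : ∀ χ φ, block U₁ χ φ ∈ localCommutant (swapState σ))
    (hs₀ : ∀ φ φ', ∑ χ, block U₀ χ φ * (block U₀ χ φ')ᴴ = if φ = φ' then 1 else 0)
    (hs₁ : ∀ φ φ', ∑ χ, block U₁ χ φ * (block U₁ χ φ')ᴴ = if φ = φ' then 1 else 0) :
    IsCompatible U₀ U₁ σ := by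
  intro ρ hρ
  have hcomm : ∀ χ φ : a₀ × a₁, (block U₀ χ.1 φ.1 ⊗ₖ block U₁ χ.2 φ.2) * σ =
      σ * (block U₀ χ.1 φ.1 ⊗ₖ block U₁ χ.2 φ.2) := by
    intro χ φ
    have e : block U₀ χ.1 φ.1 ⊗ₖ block U₁ χ.2 φ.2 =
        (block U₀ χ.1 φ.1 ⊗ₖ 1) * (1 ⊗ₖ block U₁ χ.2 φ.2) := by
      rw [← mul_kronecker_mul, Matrix.mul_one, Matrix.one_mul]
    rw [e]
    exact (mem_localCommutant.mp (hm₀ _ _)).mul_left (mem_localCommutant_swapState.mp (hm₁ _ _))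
  have hsum : ∀ φ φ' : a₀ × a₁, ∑ χ : a₀ × a₁, (block U₀ χ.1 φ.1 ⊗ₖ block U₁ χ.2 φ.2) *
      (block U₀ χ.1 φ'.1 ⊗ₖ block U₁ χ.2 φ'.2)ᴴ = if φ = φ' then 1 else 0 := by
    intro φ φ'
    have e : ∑ χ : a₀ × a₁, (block U₀ χ.1 φ.1 ⊗ₖ block U₁ χ.2 φ.2) *
        (block U₀ χ.1 φ'.1 ⊗ₖ block U₁ χ.2 φ'.2)ᴴ =
        (∑ χ, block U₀ χ φ.1 * (block U₀ χ φ'.1)ᴴ) ⊗ₖ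
          (∑ χ, block U₁ χ φ.2 * (block U₁ χ φ'.2)ᴴ) := by
      simp only [conjTranspose_kronecker, ← mul_kronecker_mul]
      ext ⟨x, y⟩ ⟨x', y'⟩
      simp only [Matrix.sum_apply, kroneckerMap_apply, Finset.sum_mul_sum,
        Fintype.sum_prod_type]
    rw [e, hs₀, hs₁]
    simp only [Prod.ext_iff]
    by_cases e₀ : φ.1 = φ'.1 <;> by_cases e₁ : φ.2 = φ'.2 <;> simp [e₀, e₁]
  rw [traceLeft_eq_sum_block]
  simp only [block_jointOutput, hcomm, Matrix.mul_assoc]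
  rw [Finset.sum_comm]
  have h1 : ∀ φ : a₀ × a₁, ∑ χ : a₀ × a₁, ∑ φ', ρ φ φ' •
      (σ * ((block U₀ χ.1 φ.1 ⊗ₖ block U₁ χ.2 φ.2) *
        (block U₀ χ.1 φ'.1 ⊗ₖ block U₁ χ.2 φ'.2)ᴴ)) = ρ φ φ • σ := by
    intro φ
    rw [Finset.sum_comm]
    simp only [← Finset.smul_sum, ← Finset.mul_sum, hsum]
    rw [Finset.sum_eq_single φ]
    · rw [if_pos rfl, Matrix.mul_one]
    · intro φ' _ hφ
      rw [if_neg (Ne.symm hφ), mul_zero, smul_zero]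
    · simp
  simp only [h1]
  rw [← Finset.sum_smul]
  have htr : ∑ φ, ρ φ φ = 1 := hρ.2
  rw [htr, one_smul]

theorem isPureState_single {n : Type*} [Fintype n] [DecidableEq n] (φ : n) :
    IsPureState (single φ φ (1 : ℂ)) := by
  have e : single φ φ (1 : ℂ) = vecMulVec (Pi.single φ 1) (star (Pi.single φ 1)) := by
    ext i j
    by_cases hi : i = φ <;> by_cases hj : j = φ <;>
      simp [vecMulVec_apply, hi, hj, eq_comm (a := φ)]
  refine ⟨⟨?_, ?_⟩, _, e⟩
  · rw [e]
    exact posSemidef_vecMulVec_self_star _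
  · simp [Matrix.trace_single_eq_same]

variable {b₀ b₁ ι₀ ι₁ : Type*} [Fintype b₀] [Fintype b₁] [Fintype ι₀] [Fintype ι₁]
  [DecidableEq b₀] [DecidableEq b₁] [DecidableEq ι₀] [DecidableEq ι₁]
  {σ : Matrix (b₀ × b₁) (b₀ × b₁) ℂ} {P₀ : ι₀ → Matrix b₀ b₀ ℂ} {t₀ : ι₀ → SectorType}
  {P₁ : ι₁ → Matrix b₁ b₁ ℂ} {t₁ : ι₁ → SectorType}

/-- Some compatible pair turns a pure state into the delocalized randomness-exhausting output. -/
theorem exists_optimal_protocol (hσ : IsState σ) (h₀ : IsEssentialDecomposition σ P₀ t₀)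
    (h₁ : IsEssentialDecomposition (swapState σ) P₁ t₁) (α : ℝ) :
    ∃ (n₀ n₁ : ℕ) (U₀ : Matrix (Fin n₀ × b₀) (Fin n₀ × b₀) ℂ)
      (U₁ : Matrix (Fin n₁ × b₁) (Fin n₁ × b₁) ℂ) (ρ : Matrix (Fin n₀ × Fin n₁) _ ℂ),
    U₀ ∈ unitaryGroup (Fin n₀ × b₀) ℂ ∧ U₁ ∈ unitaryGroup (Fin n₁ × b₁) ℂ ∧
    IsCompatible U₀ U₁ σ ∧ IsPureState ρ ∧
    delocalizedCatalyticEntropy α σ P₀ t₀ P₁ t₁ = renyiEntropy α (catalyticMap U₀ U₁ σ ρ) := by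
  -- The sector weights sum to one, so there is at least one pair of sectors to supply the initial
  -- register values.
  have hne : Nonempty (ι₀ × ι₁) := by
    by_contra hempty
    rw [not_nonempty_iff] at hempty
    have := sum_sectorWeight hσ h₀ h₁
    rw [← Fintype.sum_prod_type' (sectorWeight σ P₀ P₁)] at this
    simp at this
  obtain ⟨i₀, j₀⟩ := hne
  have hne₀ : Nonempty ι₀ := ⟨i₀⟩
  have hne₁ : Nonempty ι₁ := ⟨j₀⟩
  have hσH := hσ.1.isHermitian
  obtain ⟨n₀, e₀, U₀, φ₀, hU₀, hm₀, hs₀, ho₀⟩ := h₀.exists_protocol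
  obtain ⟨n₁, e₁, U₁, φ₁, hU₁, hm₁, hs₁, ho₁⟩ := h₁.exists_protocol
  refine ⟨n₀, n₁, U₀, U₁, single (φ₀, φ₁) (φ₀, φ₁) 1, hU₀, hU₁,
    isCompatible_of_block_mem hm₀ hm₁ hs₀ hs₁, isPureState_single _, ?_⟩
  -- A register value determines its sector, so at most one pair of sectors contributes to each
  -- entry, and only on the diagonal. The output is therefore diagonal with the eigenvalues of the
  -- DREO, each repeated once per pair of labels.
  have hN : catalyticMap U₀ U₁ σ (single (φ₀, φ₁) (φ₀, φ₁) 1) =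
      diagonal fun χ : Fin n₀ × Fin n₁ =>
        ((dreoEigenvalue σ P₀ t₀ P₁ t₁ (e₀ χ.1).1 (e₁ χ.2).1 : ℝ) : ℂ) := by
    ext χ χ'
    rw [catalyticMap_apply, Finset.sum_eq_single (φ₀, φ₁), Finset.sum_eq_single (φ₀, φ₁)]
    · rw [single_apply_same, one_mul, trace_kronecker_mul_eq_sum hσH h₀ h₁
        (mul_mem (conjTranspose_mem_localCommutant hσH (hm₀ _ _)) (hm₀ _ _))
        (mul_mem (conjTranspose_mem_localCommutant (isHermitian_swapState hσH) (hm₁ _ _))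
          (hm₁ _ _))]
      simp only [ho₀, ho₁]
      rw [Finset.sum_eq_single (e₀ χ.1).1, Finset.sum_eq_single (e₁ χ.2).1]
      · by_cases hχ : χ = χ'
        · subst hχ
          simp only [and_self, if_true, diagonal_apply_eq, dreoEigenvalue]
          rw [← ofReal_sectorWeight hσ h₀ h₁]
          push_cast
          rw [div_eq_mul_inv, mul_inv, mul_assoc]
        · rw [diagonal_apply_ne _ hχ]
          rw [Prod.ext_iff, not_and_or] at hχ
          rcases hχ with hχ | hχ <;> simp [hχ]
      · intro j _ hj
        rw [if_neg (c := χ.2 = χ'.2 ∧ _) (fun h => hj h.2.symm), mul_zero]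
      · simp
      · intro i _ hi
        refine Finset.sum_eq_zero fun j _ => ?_
        rw [if_neg (c := χ.1 = χ'.1 ∧ _) (fun h => hi h.2.symm), mul_zero, zero_mul]
      · simp
    · intro φ' _ hφ'
      rw [single_apply_of_ne (h := fun h => hφ' h.2.symm), zero_mul]
    · simp
    · intro φ _ hφ
      refine Finset.sum_eq_zero fun φ' _ => ?_
      rw [single_apply_of_ne (h := fun h => hφ h.1.symm), zero_mul]
    · simp
  rw [hN, renyiEntropy_diagonal, delocalizedCatalyticEntropy_eq hσ h₀ h₁]
  refine familyEntropy_congr (fun f => ?_) α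
  rw [Fintype.sum_sigma, Fintype.sum_prod_type, Fintype.sum_prod_type]
  rw [e₀.sum_comp (fun s => ∑ y, f (dreoEigenvalue σ P₀ t₀ P₁ t₁ s.1 (e₁ y).1)), Fintype.sum_sigma]
  refine Finset.sum_congr rfl fun i _ => ?_
  have : ∀ i, ∑ y, f (dreoEigenvalue σ P₀ t₀ P₁ t₁ i (e₁ y).1) =
      ∑ j, ∑ _y : Fin (outputDim (t₁ j) (P₁ j).rank), f (dreoEigenvalue σ P₀ t₀ P₁ t₁ i j) := by
    intro i
    rw [e₁.sum_comp (fun s => f (dreoEigenvalue σ P₀ t₀ P₁ t₁ i s.1)), Fintype.sum_sigma]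
  simp only [this]
  rw [Finset.sum_comm]
  simp only [Fintype.sum_prod_type]

end Attainability

end DelocalizedCatalysis

open DelocalizedCatalysis

theorem mainTheorem1 {b₀ b₁ ι₀ ι₁ : Type*}
    [Fintype b₀] [Fintype b₁] [Fintype ι₀] [Fintype ι₁]
    [DecidableEq b₀] [DecidableEq b₁] [DecidableEq ι₀] [DecidableEq ι₁]
    (σ : Matrix (b₀ × b₁) (b₀ × b₁) ℂ) (hσ : IsState σ)
    (P₀ : ι₀ → Matrix b₀ b₀ ℂ) (t₀ : ι₀ → SectorType)
    (h₀ : IsEssentialDecomposition σ P₀ t₀)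
    (P₁ : ι₁ → Matrix b₁ b₁ ℂ) (t₁ : ι₁ → SectorType)
    (h₁ : IsEssentialDecomposition (swapState σ) P₁ t₁)
    (α : ℝ) (hα : 0 ≤ α) :
    IsGreatest (extractable α σ) (delocalizedCatalyticEntropy α σ P₀ t₀ P₁ t₁) ∧
      IsGreatest (extractableFromPure α σ) (delocalizedCatalyticEntropy α σ P₀ t₀ P₁ t₁) := by
  obtain ⟨n₀, n₁, U₀, U₁, ρ, hU₀, hU₁, hc, hρ, hs⟩ := exists_optimal_protocol hσ h₀ h₁ α
  refine ⟨⟨⟨n₀, n₁, U₀, U₁, ρ, hU₀, hU₁, hc, hρ.1, ?_⟩, ?_⟩,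
    ⟨⟨n₀, n₁, U₀, U₁, ρ, hU₀, hU₁, hc, hρ, hs⟩, ?_⟩⟩
  · rw [renyiEntropy_of_isPureState hρ, sub_zero, hs]
  · rintro s ⟨m₀, m₁, V₀, V₁, ω, hV₀, hV₁, hcV, hω, rfl⟩
    rw [sub_le_iff_le_add]
    exact renyiEntropy_catalyticMap_le hσ h₀ h₁ hV₀ hV₁ hcV hω hα
  · rintro s ⟨m₀, m₁, V₀, V₁, ω, hV₀, hV₁, hcV, hω, rfl⟩
    have := renyiEntropy_catalyticMap_le hσ h₀ h₁ hV₀ hV₁ hcV hω.1 hα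
    rwa [renyiEntropy_of_isPureState hω, add_zero] at this
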